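/- **Setting.** For $N\ge 1$ let $[N]=\{0,\dots,N-1\}$ and let $\nu:[N]\to[N]$ be an involution. A *1-ket-sparse Lindbladian* with neighbor function $\nu$ is a superoperator on $N\times N$ complex matrices of the form $$\mathcal L(\rho)=\sum_{k,l,k',l'\in[N]}A_{(k,l),(k',l')}\big(2\langle l|\rho|l'\rangle|k\rangle\langle k'|-\delta_{kk'}|l'\rangle\langle l|\rho-\delta_{kk'}\rho|l'\rangle\langle l|\big),$$ where $A$ is a positive semidefinite $N^2\times N^2$ matrix whose only possibly nonzero entries are $a_{k,l}:=A_{(k,l),(k,l)}$ and $b_{k,l}:=A_{(k,l),(\nu(k),l)}$ with $l\in\{k,\nu(k)\}$, and such that for each $x\in[N]$ there are real numbers $a_{\{x,\nu(x)\}}$, $a'_{\{x,\nu(x)\}}$, $b_{\{x,\nu(x)\}}$ with $$a_{x,\nu(x)}=a_{\nu(x),x}=a_{\{x,\nu(x)\}},\qquad a_{x,x}=a_{\nu(x),\nu(x)}=a'_{\{x,\nu(x)\}},\qquad b_{x,x}=b_{x,\nu(x)}=b_{\nu(x),x}=b_{\nu(x),\nu(x)}=b_{\{x,\nu(x)\}}.$$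 When $\nu$ has no fixed points this reads $$\begin{aligned}\mathcal L(\rho)={}&\sum_{k}a_{\{k,\nu(k)\}}\big(2\langle \nu(k)|\rho|\nu(k)\rangle|k\rangle\langle k|-|\nu(k)\rangle\langle\nu(k)|\rho-\rho|\nu(k)\rangle\langle\nu(k)|\big)\\&+\sum_{k}a'_{\{k,\nu(k)\}}\big(2\langle k|\rho|k\rangle|k\rangle\langle k|-|k\rangle\langle k|\rho-\rho|k\rangle\langle k|\big)+2\sum_k b_{\{k,\nu(k)\}}\big(\langle k|\rho|k\rangle+\langle\nu(k)|\rho|\nu(k)\rangle\big)|k\rangle\langle\nu(k)|.\end{aligned}$$ **Model.** Elements of $[N]$ are stored in binary on $n=\lceil\log_2N\rceil$ qubits. A circuit acts on $n$ system qubits, finitely many ancilla qubits, and a coefficient register whose basis states are the triples $z\in\mathbb R^3$. Its steps are (i) 2-qubit gates, i.e. arbitrary unitaries on two qubits, which may be chosen depending on the content $z$ of the coefficient register (processing the numerical values returned by the black box is not charged); and (ii) queries to the black box or its inverse, acting on two disjoint $n$-qubit registers and the coefficient register by $$|x\rangle|y\rangle|z\rangle\mapsto|x\rangle|y\oplus\nu(x)\rangle|z\pm(a_{\{x,\nu(x)\}},a'_{\{x,\nu(x)\}},b_{\{x,\nu(x)\}})\rangle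 ,\qquad x\in[N],$$ and trivially if the input register does not encode an element of $[N]$. A circuit performs the operation obtained by initializing the ancilla qubits to $|0\rangle$ and the coefficient register to $|(0,0,0)\rangle$, running the circuit, and tracing out everything except the system qubits. **Theorem.** There are absolute constants $C$ and $Q$ such that for every $N\ge1$ and every $t>0$ there is a circuit with at most $C\log N$ 2-qubit gates and at most $Q$ queries which, for every involution $\nu$ of $[N]$ and every 1-ket-sparse Lindbladian $\mathcal L$ with neighbor function $\nu$, when run with the black box of $\mathcal L$ performs the map $\rho\mapsto e^{\mathcal Lt}(\rho)$ exactly (with no error). That is, 1-ket-sparse Lindbladians can be simulated for any time $t>0$ with $O(\log N)$ 2-qubit gates and $O(1)$ queries, with no error. -/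

import Mathlib

open scoped Matrix ComplexOrder

noncomputable section

namespace OneKet

/-! ### Lindbladians -/

/-- The superoperator with zero Hamiltonian part attached to an `N² × N²` matrix `A` (the
overcomplete Gorini-Kossakowski-Sudarshan form):
`ρ ↦ ∑ A_{(k,l),(k',l')} (2⟨l|ρ|l'⟩ |k⟩⟨k'| - δ_{kk'} |l'⟩⟨l| ρ - δ_{kk'} ρ |l'⟩⟨l|)`,
where `p = (k, l)` and `q = (k', l')`. -/
def gks {N : ℕ} (A : Matrix (Fin N × Fin N) (Fin N × Fin N) ℂ) :
    Matrix (Fin N) (Fin N) ℂ →ₗ[ℂ] Matrix (Fin N) (Fin N) ℂ where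
  toFun ρ := ∑ p : Fin N × Fin N, ∑ q : Fin N × Fin N, A p q •
    ((2 * ρ p.2 q.2) • Matrix.single p.1 q.1 (1 : ℂ)
      - (if p.1 = q.1 then (1 : ℂ) else 0) • (Matrix.single q.2 p.2 (1 : ℂ) * ρ)
      - (if p.1 = q.1 then (1 : ℂ) else 0) • (ρ * Matrix.single q.2 p.2 (1 : ℂ)))
  map_add' ρ σ := by
    simp only [← Finset.sum_add_distrib]
    refine Finset.sum_congr rfl fun p _ => Finset.sum_congr rfl fun q _ => ?_
    rw [← smul_add]
    congr 1
    simp only [Matrix.add_apply, mul_add, add_mul, add_smul, smul_add]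
    abel
  map_smul' c ρ := by
    simp only [RingHom.id_apply, Finset.smul_sum]
    refine Finset.sum_congr rfl fun p _ => Finset.sum_congr rfl fun q _ => ?_
    rw [smul_comm c (A p q)]
    congr 1
    simp only [Matrix.smul_apply, smul_eq_mul, Matrix.mul_smul, Matrix.smul_mul, smul_sub,
      smul_smul]
    congr 2
    · congr 1; ring
    · rw [mul_comm]
    · rw [mul_comm]

/-- `A` is the coefficient matrix of a 1-ket-sparse Lindbladian with neighbour function `ν`.
Writing `a_{k,l} = A_{(k,l),(k,l)}` and `b_{k,l} = A_{(k,l),(ν(k),l)}`: these are the only entries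
of `A` that may be nonzero, they vanish unless `l ∈ {k, ν(k)}`, and their values are given by the
real coefficients `a`, `a'`, `b` as listed. -/
structure IsOneKetSparse {N : ℕ} (ν : Fin N → Fin N) (a a' b : Fin N → ℝ)
    (A : Matrix (Fin N × Fin N) (Fin N × Fin N) ℂ) : Prop where
  involutive : Function.Involutive ν
  posSemidef : A.PosSemidef
  support : ∀ k l k' l', A (k, l) (k', l') ≠ 0 →
    l' = l ∧ (k' = k ∨ k' = ν k) ∧ (l = k ∨ l = ν k)
  a_eq : ∀ x, A (x, ν x) (x, ν x) = a x
  a_eq_swap : ∀ x, A (ν x, x) (ν x, x) = a x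
  a'_eq : ∀ x, A (x, x) (x, x) = a' x
  a'_eq_swap : ∀ x, A (ν x, ν x) (ν x, ν x) = a' x
  b_self : ∀ x, A (x, x) (ν x, x) = b x
  b_right : ∀ x, A (x, ν x) (ν x, ν x) = b x
  b_left : ∀ x, A (ν x, x) (x, x) = b x
  b_both : ∀ x, A (ν x, ν x) (x, ν x) = b x

/-- The time evolution `e^{tL}` generated by a superoperator `L`, as its power series (which always
converges, see `hasSum_evolution`). -/
def evolution {N : ℕ} (L : Matrix (Fin N) (Fin N) ℂ →ₗ[ℂ] Matrix (Fin N) (Fin N) ℂ) (t : ℝ)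
    (ρ : Matrix (Fin N) (Fin N) ℂ) : Matrix (Fin N) (Fin N) ℂ :=
  ∑' j : ℕ, ((t : ℂ) ^ j / (j.factorial : ℂ)) • (L ^ j) ρ

/-! ### Circuits with a black box -/

/-- Values `(a, a', b)` held by the coefficient register. -/
abbrev Coeffs := ℝ × ℝ × ℝ

/-- Number of qubits `⌈log₂ N⌉` that hold an element of `{0, …, N-1}`. -/
abbrev width (N : ℕ) : ℕ := Nat.clog 2 N

/-- The qubits: the system register followed by `m` ancilla qubits. -/
abbrev Wire (N m : ℕ) := Fin (width N) ⊕ Fin m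

/-- Computational basis states: a bit for each qubit, and the content of the coefficient register. -/
abbrev BasisState (N m : ℕ) := (Wire N m → Bool) × Coeffs

/-- State vectors: finite linear combinations of basis states. -/
abbrev State (N m : ℕ) := BasisState N m →₀ ℂ

/-- Binary encoding of an element of `{0, …, N-1}`. -/
def encode {N : ℕ} (x : Fin N) : Fin (width N) → Bool := fun i => (x : ℕ).testBit i

/-- A black box: on input `x` it outputs `ν(x)` and the three coefficients at `x`. -/
structure Oracle (N : ℕ) where
  nbr : Fin N → Fin N
  coeffs : Fin N → Coeffs

/-- One step of a circuit: a two-qubit gate on two distinct qubits, which may depend on the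
coefficients currently in the coefficient register, or a call to the black box (`inv = false`) or
its inverse (`inv = true`) on disjoint input and output registers. -/
inductive Step (N m : ℕ) where
  | gate (i j : Wire N m) (hij : i ≠ j)
      (U : Coeffs → Matrix.unitaryGroup (Bool × Bool) ℂ) : Step N m
  | query (inp out : Fin (width N) ↪ Wire N m) (hdisj : ∀ k l, inp k ≠ out l)
      (inv : Bool) : Step N m

/-- Adds (mod 2) the bit string `y` to the qubits listed by `out`. -/
def xorAt {N m : ℕ} (out : Fin (width N) ↪ Wire N m) (y : Fin (width N) → Bool)
    (w : Wire N m → Bool) : Wire N m → Bool :=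
  fun v => w v ^^ decide (∃ k, out k = v ∧ y k = true)

open Classical in
/-- Action of a step on a basis state. The black box maps
`|x⟩|y⟩|z⟩ ↦ |x⟩|y ⊕ ν(x)⟩|z ± (a(x), a'(x), b(x))⟩` and acts trivially if its input
register does not encode an element of `{0, …, N-1}`. -/
def Step.onBasis {N m : ℕ} (O : Oracle N) : Step N m → BasisState N m → State N m
  | .gate i j _ U, (w, z) =>
      ∑ p : Bool, ∑ q : Bool,
        Finsupp.single (Function.update (Function.update w i p) j q, z)
          ((U z : Matrix (Bool × Bool) (Bool × Bool) ℂ) (p, q) (w i, w j))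
  | .query inp out _ inv, (w, z) =>
      if h : ∃ x : Fin N, encode x = w ∘ inp then
        Finsupp.single
          (xorAt out (encode (O.nbr h.choose)) w,
            if inv then z - O.coeffs h.choose else z + O.coeffs h.choose) 1
      else Finsupp.single (w, z) 1

/-- Linear extension of `Step.onBasis` to all state vectors. -/
def Step.apply {N m : ℕ} (O : Oracle N) (s : Step N m) : State N m →ₗ[ℂ] State N m :=
  Finsupp.linearCombination ℂ (s.onBasis O)

/-- A circuit: a list of steps, executed from left to right. -/
abbrev Circuit (N m : ℕ) := List (Step N m)

/-- Number of two-qubit gates. -/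
def gateCount {N m : ℕ} : Circuit N m → ℕ
  | [] => 0
  | .gate _ _ _ _ :: P => gateCount P + 1
  | .query _ _ _ _ :: P => gateCount P

/-- Number of calls to the black box or its inverse. -/
def queryCount {N m : ℕ} : Circuit N m → ℕ
  | [] => 0
  | .gate _ _ _ _ :: P => queryCount P
  | .query _ _ _ _ :: P => queryCount P + 1

/-- The state vector obtained by running a circuit. -/
def run {N m : ℕ} (O : Oracle N) (P : Circuit N m) (ψ : State N m) : State N m :=
  P.foldl (fun φ s => s.apply O φ) ψ

/-- Initial state `|x⟩|0…0⟩|(0,0,0)⟩`. -/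
def initial {N : ℕ} (m : ℕ) (x : Fin N) : State N m :=
  Finsupp.single (Sum.elim (encode x) fun _ => false, 0) 1

/-- The inner product `⟨φ_{l}|ψ_{k}⟩` of the parts of `ψ` and `φ` whose system registers contain `k`
and `l`, i.e. the `(k, l)` entry of the partial trace of `|ψ⟩⟨φ|` over everything but the system. -/
def traceOut {N m : ℕ} (ψ φ : State N m) :
    Matrix (Fin (width N) → Bool) (Fin (width N) → Bool) ℂ :=
  fun k l => ∑ g : Fin m → Bool, ψ.sum fun s c =>
    if s.1 = Sum.elim k g then c * star (φ (Sum.elim l g, s.2)) else 0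

/-- The quantum operation performed by a circuit: the ancillas start in the zero state, the circuit is
run, and everything but the system register is traced out. The output is a matrix on all
`⌈log₂ N⌉`-bit strings. -/
def channel {N m : ℕ} (O : Oracle N) (P : Circuit N m) (ρ : Matrix (Fin N) (Fin N) ℂ) :
    Matrix (Fin (width N) → Bool) (Fin (width N) → Bool) ℂ :=
  ∑ x : Fin N, ∑ y : Fin N,
    ρ x y • traceOut (run O P (initial m x)) (run O P (initial m y))

/-- An `N × N` matrix, viewed as a matrix on bit strings through the binary encoding. -/
def embed {N : ℕ} (M : Matrix (Fin N) (Fin N) ℂ) :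
    Matrix (Fin (width N) → Bool) (Fin (width N) → Bool) ℂ :=
  ∑ k : Fin N, ∑ l : Fin N, Matrix.single (encode k) (encode l) (M k l)

/-! ### Facts that confirm the definitions -/

theorem summable_exp {E : Type*} [NormedAddCommGroup E] [NormedSpace ℂ E] [FiniteDimensional ℂ E]
    (L : E →ₗ[ℂ] E) (t : ℝ) (ρ : E) :
    Summable (fun j : ℕ => ((t : ℂ) ^ j / (j.factorial : ℂ)) • (L ^ j) ρ) := by
  let T := LinearMap.toContinuousLinearMap L
  have hT : ∀ j : ℕ, ‖(L ^ j) ρ‖ ≤ ‖T‖ ^ j * ‖ρ‖ := by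
    intro j
    induction j with
    | zero => simp
    | succ j ih =>
      rw [pow_succ', Module.End.mul_apply]
      calc ‖L ((L ^ j) ρ)‖ = ‖T ((L ^ j) ρ)‖ := rfl
        _ ≤ ‖T‖ * ‖(L ^ j) ρ‖ := T.le_opNorm _
        _ ≤ ‖T‖ * (‖T‖ ^ j * ‖ρ‖) := by gcongr
        _ = ‖T‖ ^ (j + 1) * ‖ρ‖ := by ring
  have : CompleteSpace E := FiniteDimensional.complete ℂ E
  refine Summable.of_norm_bounded
    (g := fun j : ℕ => (|t| * ‖T‖) ^ j / (j.factorial : ℝ) * ‖ρ‖)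
    ((Real.summable_pow_div_factorial _).mul_right _) fun j => ?_
  rw [norm_smul]
  have : ‖(t : ℂ) ^ j / (j.factorial : ℂ)‖ = |t| ^ j / (j.factorial : ℝ) := by simp
  rw [this]
  calc |t| ^ j / (j.factorial : ℝ) * ‖(L ^ j) ρ‖
      ≤ |t| ^ j / (j.factorial : ℝ) * (‖T‖ ^ j * ‖ρ‖) := by gcongr; exact hT j
    _ = _ := by rw [mul_pow]; ring

theorem hasSum_evolution {N : ℕ}
    (L : Matrix (Fin N) (Fin N) ℂ →ₗ[ℂ] Matrix (Fin N) (Fin N) ℂ) (t : ℝ)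
    (ρ : Matrix (Fin N) (Fin N) ℂ) :
    HasSum (fun j : ℕ => ((t : ℂ) ^ j / (j.factorial : ℂ)) • (L ^ j) ρ) (evolution L t ρ) :=
  Summable.hasSum (summable_exp (E := Fin N → Fin N → ℂ) L t ρ)

theorem encode_injective {N : ℕ} : Function.Injective (encode : Fin N → _) := by
  intro x y h
  apply Fin.ext
  apply Nat.eq_of_testBit_eq
  intro i
  by_cases hi : i < width N
  · exact congrFun h ⟨i, hi⟩
  · have hN : N ≤ 2 ^ i := (Nat.le_pow_clog one_lt_two N).trans
      (Nat.pow_le_pow_right two_pos (not_lt.1 hi))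
    rw [Nat.testBit_lt_two_pow (x.2.trans_le hN), Nat.testBit_lt_two_pow (y.2.trans_le hN)]

/-- If `ν` has no fixed points, a 1-ket-sparse Lindbladian has the expected explicit form. -/
theorem IsOneKetSparse.gks_apply {N : ℕ} {ν : Fin N → Fin N} {a a' b : Fin N → ℝ}
    {A : Matrix (Fin N × Fin N) (Fin N × Fin N) ℂ} (h : IsOneKetSparse ν a a' b A)
    (hν : ∀ x, ν x ≠ x) (ρ : Matrix (Fin N) (Fin N) ℂ) :
    gks A ρ =
      ∑ k, (a k : ℂ) • ((2 * ρ (ν k) (ν k)) • Matrix.single k k (1 : ℂ)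
        - Matrix.single (ν k) (ν k) (1 : ℂ) * ρ - ρ * Matrix.single (ν k) (ν k) (1 : ℂ))
      + ∑ k, (a' k : ℂ) • ((2 * ρ k k) • Matrix.single k k (1 : ℂ)
        - Matrix.single k k (1 : ℂ) * ρ - ρ * Matrix.single k k (1 : ℂ))
      + (2 : ℂ) • ∑ k, ((b k : ℂ) * (ρ k k + ρ (ν k) (ν k))) • Matrix.single k (ν k) (1 : ℂ) := by
  have key : ∀ (F : Fin N × Fin N → Fin N × Fin N → Matrix (Fin N) (Fin N) ℂ) (k : Fin N),
      ∑ l, ∑ q, A (k, l) q • F (k, l) q =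
        (a k : ℂ) • F (k, ν k) (k, ν k) + (a' k : ℂ) • F (k, k) (k, k)
        + ((b k : ℂ) • F (k, k) (ν k, k) + (b k : ℂ) • F (k, ν k) (ν k, ν k)) := by
    intro F k
    have inner : ∀ l, ∑ q, A (k, l) q • F (k, l) q =
        A (k, l) (k, l) • F (k, l) (k, l) + A (k, l) (ν k, l) • F (k, l) (ν k, l) := by
      intro l
      rw [← Finset.sum_pair (f := fun q => A (k, l) q • F (k, l) q)
        (a := (k, l)) (b := (ν k, l)) (by simpa using fun e => hν k e.symm)]
      symm
      refine Finset.sum_subset (Finset.subset_univ _) fun q _ hq => ?_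
      by_cases h0 : A (k, l) q = 0
      · simp [h0]
      · obtain ⟨h1, h2, -⟩ := h.support k l q.1 q.2 h0
        exfalso
        apply hq
        rcases h2 with h2 | h2 <;> simp [Prod.ext_iff, h1, h2]
    simp only [inner]
    rw [← Finset.sum_subset (Finset.subset_univ {k, ν k}), Finset.sum_pair (hν k).symm,
      h.a_eq, h.a'_eq, h.b_self, h.b_right]
    · abel
    · intro l _ hl
      have h0 : ∀ q, A (k, l) q = 0 := by
        intro q
        by_contra h0
        obtain ⟨-, -, h3⟩ := h.support k l q.1 q.2 h0
        exact hl (by simpa using h3)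
      simp [h0]
  change (∑ p : Fin N × Fin N, ∑ q : Fin N × Fin N, _) = _
  rw [Fintype.sum_prod_type]
  rw [Finset.sum_congr rfl fun k _ => key (fun p q =>
    (2 * ρ p.2 q.2) • Matrix.single p.1 q.1 (1 : ℂ)
      - (if p.1 = q.1 then (1 : ℂ) else 0) • (Matrix.single q.2 p.2 (1 : ℂ) * ρ)
      - (if p.1 = q.1 then (1 : ℂ) else 0) • (ρ * Matrix.single q.2 p.2 (1 : ℂ))) k]
  rw [Finset.sum_add_distrib, Finset.sum_add_distrib, Finset.smul_sum]
  have e : ∀ k, (k = ν k) = False := fun k => by simpa using (hν k).symm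
  simp only [e, if_true, if_false, one_smul, zero_smul, sub_zero]
  congr 1
  refine Finset.sum_congr rfl fun k _ => ?_
  rw [smul_smul, smul_smul, smul_smul, ← add_smul]
  congr 1
  ring

end OneKet

end

/-!
Fix a pair `{x, y}` with `y = ν x ≠ x` and write `γ = a + a'`. The generator multiplies a coherence
`|x⟩⟨x'|` between distinct basis states by `-(γ_x + γ_x')`, and a population spreads over its pair:
`|x⟩⟨x|` is a combination of eigenvectors supported on the pair
(`IsOneKetSparse.evolution_single_self`). At a fixed point of `ν` the rate is `γ = a` and the
population is constant. So `e^{tL}` is the following operation: keep the state with amplitude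
`e^{-γt}`; with the remaining probability `1 - e^{-2γt}`, a jump takes place, in which the basis
state `x` is measured and replaced by a state of its pair with populations `1 - q` and `q` and
coherence `b / γ`, where `q = (1 - e^{-4at}) / (2 (1 - e^{-2γt}))`. That matrix is positive
semidefinite: `A ≥ 0` gives `b² ≤ a a'`, and concavity of `1 - e^{-u}` puts `q` between `a / γ` and
`1/2` (`swapProb_spec`). Its entries depend only on the three coefficients, hence can be
produced by rotations whose angles are read off from the coefficient register.

The circuit conjugates this by a reversible preparation. One query writes `ν x` next to `x`; with
`δ = x ⊕ ν x`, a scan for the first position where `δ` holds finds out whether `x ≠ ν x` and yields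
one bit, the side, which separates `x` from `ν x`. Adding `δ` to the system if the side is set turns
the system into a canonical member of the pair. Now everything but the side depends on the pair
only, so the jump is an operation on a single qubit, together with a record of the canonical member.
That changing the side and then undoing the preparation moves the system to the other member of the
pair is `Register.prepared_hop`. Undoing the preparation clears the work qubits and the coefficient
register with a second query, so states of different pairs stay coherent unless a jump has taken
place. After a jump the environment holds the canonical member and the old side, which determine
`x` (`Register.eq_of_prepared_eq`), so it has been measured.

All loops run over the `⌈log₂ N⌉` positions, with a bounded number of two-qubit gates at each; a
doubly controlled flip takes five of them (`run_toffoli`).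
-/

noncomputable section

namespace OneKet

/-! ### Time evolution of a 1-ket-sparse Lindbladian -/

section Evolution

variable {N : ℕ} (L : Matrix (Fin N) (Fin N) ℂ →ₗ[ℂ] Matrix (Fin N) (Fin N) ℂ) (t : ℝ)

theorem evolution_add (ρ σ : Matrix (Fin N) (Fin N) ℂ) :
    evolution L t (ρ + σ) = evolution L t ρ + evolution L t σ := by
  refine (hasSum_evolution L t (ρ + σ)).unique ?_
  simpa only [map_add, smul_add] using (hasSum_evolution L t ρ).add (hasSum_evolution L t σ)

theorem evolution_smul (c : ℂ) (ρ : Matrix (Fin N) (Fin N) ℂ) :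
    evolution L t (c • ρ) = c • evolution L t ρ := by
  refine (hasSum_evolution L t (c • ρ)).unique ?_
  simpa only [map_smul, smul_comm c] using (hasSum_evolution L t ρ).const_smul c

theorem evolution_sum {ι : Type*} (s : Finset ι) (ρ : ι → Matrix (Fin N) (Fin N) ℂ) :
    evolution L t (∑ i ∈ s, ρ i) = ∑ i ∈ s, evolution L t (ρ i) := by
  let E : Matrix (Fin N) (Fin N) ℂ →ₗ[ℂ] Matrix (Fin N) (Fin N) ℂ :=
    ⟨⟨evolution L t, evolution_add L t⟩, evolution_smul L t⟩
  exact map_sum E ρ s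

theorem evolution_of_eigenvector {v : Matrix (Fin N) (Fin N) ℂ} {c : ℂ} (h : L v = c • v) :
    evolution L t v = Complex.exp (t * c) • v := by
  have hpow : ∀ j : ℕ, (L ^ j) v = c ^ j • v := by
    intro j
    induction j with
    | zero => simp
    | succ j ih => rw [pow_succ', Module.End.mul_apply, ih, map_smul, h, smul_smul, pow_succ]
  refine (hasSum_evolution L t v).unique ?_
  have hexp : HasSum (fun j : ℕ => ((t : ℂ) * c) ^ j / (j.factorial : ℂ))
      (Complex.exp (t * c)) := by
    rw [Complex.exp_eq_exp_ℂ]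
    exact NormedSpace.expSeries_div_hasSum_exp _
  convert hexp.smul_const v using 2 with j
  rw [hpow, smul_smul, mul_pow]
  congr 1
  ring

end Evolution

section Lindblad

variable {N : ℕ} {ν : Fin N → Fin N} {a a' b : Fin N → ℝ}
  {A : Matrix (Fin N × Fin N) (Fin N × Fin N) ℂ}

/-- The rate at which coherences of the basis state `x` decay. At a fixed point of `ν` the entries
`a x` and `a' x` are the same entry of the coefficient matrix and count once. -/
def decayRate (ν : Fin N → Fin N) (a a' : Fin N → ℝ) (x : Fin N) : ℝ :=
  if ν x = x then a x else a x + a' x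

namespace IsOneKetSparse

/-- The support condition on the coefficient matrix, in the form in which it is applied. -/
theorem eq_zero (h : IsOneKetSparse ν a a' b A) {k l k' l' : Fin N}
    (hn : ¬ (l' = l ∧ (k' = k ∨ k' = ν k) ∧ (l = k ∨ l = ν k))) : A (k, l) (k', l') = 0 := by
  by_contra h0
  exact hn (h.support _ _ _ _ h0)

/-- The loss terms of the generator are diagonal, with the decay rates as entries. -/
theorem sum_eq_decayRate (h : IsOneKetSparse ν a a' b A) (l : Fin N) :
    ∑ k, A (k, l) (k, l) = (decayRate ν a a' l : ℂ) := by
  have hz : ∀ k, k ≠ l → k ≠ ν l → A (k, l) (k, l) = 0 := fun k h1 h2 =>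
    h.eq_zero fun ⟨_, _, h3⟩ => h3.elim (fun e => h1 e.symm)
      fun e => h2 (by rw [e, h.involutive])
  by_cases hf : ν l = l
  · rw [Finset.sum_eq_single l (fun k _ hk => hz k hk (by rwa [hf])) (by simp)]
    have := h.a_eq l
    rw [hf] at this
    rw [this, decayRate, if_pos hf]
  · rw [← Finset.sum_subset (Finset.subset_univ {l, ν l}), Finset.sum_pair (Ne.symm hf),
      h.a'_eq, h.a_eq_swap, decayRate, if_neg hf]
    · push_cast; ring
    · intro k _ hk
      simp only [Finset.mem_insert, Finset.mem_singleton, not_or] at hk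
      exact hz k hk.1 hk.2

/-- Only the diagonal entries of `ρ` are fed back: the gain term of the generator involves `ρ l l'`
with the coefficient `A (i, l) (j, l')`, which vanishes for `l' ≠ l`. -/
theorem gks_entry (h : IsOneKetSparse ν a a' b A) (ρ : Matrix (Fin N) (Fin N) ℂ) (i j : Fin N) :
    gks A ρ i j = 2 * ∑ l, A (i, l) (j, l) * ρ l l
      - (decayRate ν a a' i + decayRate ν a a' j) * ρ i j := by
  have hdiag : ∀ k l l', l' ≠ l → ∀ k', A (k, l) (k', l') = 0 := fun k l l' hl k' =>
    h.eq_zero fun e => hl e.1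
  have e1 : gks A ρ i j = ∑ k, ∑ l, ∑ k', ∑ l', A (k, l) (k', l') *
      (2 * ρ l l' * (if k = i ∧ k' = j then 1 else 0)
        - (if k = k' then 1 else 0) * (if l' = i then ρ l j else 0)
        - (if k = k' then 1 else 0) * (if l = j then ρ i l' else 0)) := by
    change (∑ p : Fin N × Fin N, ∑ q : Fin N × Fin N, _ : Matrix (Fin N) (Fin N) ℂ) i j = _
    simp only [Fintype.sum_prod_type, Matrix.sum_apply, Matrix.smul_apply, Matrix.sub_apply,
      smul_eq_mul, Matrix.mul_apply, Matrix.single_apply]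
    refine Finset.sum_congr rfl fun k _ => Finset.sum_congr rfl fun l _ =>
      Finset.sum_congr rfl fun k' _ => Finset.sum_congr rfl fun l' _ => ?_
    congr 3
    · by_cases h1 : l' = i <;> simp [h1]
    · by_cases h1 : l = j <;> simp [h1]
  have e2 : ∀ k l, ∑ k', ∑ l', A (k, l) (k', l') *
      (2 * ρ l l' * (if k = i ∧ k' = j then 1 else 0)
        - (if k = k' then 1 else 0) * (if l' = i then ρ l j else 0)
        - (if k = k' then 1 else 0) * (if l = j then ρ i l' else 0)) =
      (if k = i then 2 * (A (k, l) (j, l) * ρ l l) else 0)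
        - (if l = i then A (k, l) (k, l) * ρ l j else 0)
        - (if l = j then A (k, l) (k, l) * ρ i l else 0) := by
    intro k l
    have e3 : ∀ k', ∑ l', A (k, l) (k', l') *
      (2 * ρ l l' * (if k = i ∧ k' = j then 1 else 0)
        - (if k = k' then 1 else 0) * (if l' = i then ρ l j else 0)
        - (if k = k' then 1 else 0) * (if l = j then ρ i l' else 0)) =
      (if k' = j then (if k = i then 2 * (A (k, l) (j, l) * ρ l l) else 0) else 0)
        - (if k = k' then (if l = i then A (k, l) (k, l) * ρ l j else 0) else 0)
        - (if k = k' then (if l = j then A (k, l) (k, l) * ρ i l else 0) else 0) := by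
      intro k'
      rw [Finset.sum_eq_single l (fun l' _ hl => by rw [hdiag _ _ _ hl, zero_mul]) (by simp)]
      rw [mul_sub, mul_sub]
      congr 1
      · congr 1
        · by_cases h1 : k' = j
          · subst h1
            by_cases h2 : k = i
            · simp only [h2, and_self, if_true]; ring
            · simp only [h2, false_and, if_true, if_false, mul_zero]
          · simp only [h1, and_false, if_false, mul_zero]
        · by_cases h1 : k = k'
          · subst h1
            simp only [if_true, one_mul, mul_ite, mul_zero]
          · simp only [h1, if_false, zero_mul, mul_zero]
      · by_cases h1 : k = k'
        · subst h1
          simp only [if_true, one_mul, mul_ite, mul_zero]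
        · simp only [h1, if_false, zero_mul, mul_zero]
    simp only [e3, Finset.sum_sub_distrib, Finset.sum_ite_eq, Finset.sum_ite_eq', Finset.mem_univ,
      if_true]
  rw [e1]
  simp only [e2, Finset.sum_sub_distrib, Finset.sum_ite_eq', Finset.mem_univ, if_true]
  rw [Finset.sum_comm]
  simp only [Finset.sum_ite_eq', Finset.mem_univ, if_true, ← Finset.sum_mul, h.sum_eq_decayRate,
    ← Finset.mul_sum]
  ring

theorem a_nonneg (h : IsOneKetSparse ν a a' b A) (x : Fin N) : 0 ≤ a x := by
  have := h.posSemidef.diag_nonneg (i := (x, ν x))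
  rw [h.a_eq] at this
  exact_mod_cast this

theorem a'_nonneg (h : IsOneKetSparse ν a a' b A) (x : Fin N) : 0 ≤ a' x := by
  have := h.posSemidef.diag_nonneg (i := (x, x))
  rw [h.a'_eq] at this
  exact_mod_cast this

/-- The principal minor of `A` on `(x, x)` and `(ν x, x)` is nonnegative. -/
theorem b_sq_le (h : IsOneKetSparse ν a a' b A) (x : Fin N) : b x ^ 2 ≤ a x * a' x := by
  have := (h.posSemidef.submatrix ![(x, x), (ν x, x)]).det_nonneg
  simp only [Matrix.det_fin_two, Matrix.submatrix_apply, Matrix.cons_val_zero,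
    Matrix.cons_val_one, h.a'_eq, h.a_eq_swap, h.b_self, h.b_left] at this
  have h2 : (0 : ℝ) ≤ a' x * a x - b x * b x := by exact_mod_cast this
  nlinarith

theorem a_nbr (h : IsOneKetSparse ν a a' b A) (x : Fin N) : a (ν x) = a x := by
  have h1 := h.a_eq (ν x)
  rw [h.involutive, h.a_eq_swap] at h1
  exact_mod_cast h1.symm

theorem a'_nbr (h : IsOneKetSparse ν a a' b A) (x : Fin N) : a' (ν x) = a' x := by
  have h1 := h.a'_eq (ν x)
  rw [h.a'_eq_swap] at h1
  exact_mod_cast h1.symm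

theorem b_nbr (h : IsOneKetSparse ν a a' b A) (x : Fin N) : b (ν x) = b x := by
  have h1 := h.b_self (ν x)
  rw [h.involutive, h.b_both] at h1
  exact_mod_cast h1.symm

theorem decayRate_nbr (h : IsOneKetSparse ν a a' b A) (x : Fin N) :
    decayRate ν a a' (ν x) = decayRate ν a a' x := by
  simp only [decayRate, h.a_nbr, h.a'_nbr, h.involutive x, eq_comm]

theorem sum_diag (A : Matrix (Fin N × Fin N) (Fin N × Fin N) ℂ) (x i j : Fin N) :
    ∑ l, A (i, l) (j, l) * Matrix.single x x (1 : ℂ) l l = A (i, x) (j, x) := by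
  rw [Finset.sum_eq_single x]
  · simp
  · intro l _ hl
    simp [Ne.symm hl]
  · simp

theorem gks_single_of_ne (h : IsOneKetSparse ν a a' b A) {x y : Fin N} (hxy : x ≠ y) :
    gks A (Matrix.single x y 1) =
      (-(decayRate ν a a' x + decayRate ν a a' y : ℂ)) • Matrix.single x y (1 : ℂ) := by
  ext i j
  rw [h.gks_entry, Finset.sum_eq_zero, Matrix.smul_apply, Matrix.single_apply]
  · split_ifs with hij
    · rw [hij.1, hij.2, smul_eq_mul]; ring
    · simp
  · intro l _
    rw [Matrix.single_apply, if_neg (fun e => hxy (e.1.trans e.2.symm)), mul_zero]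

/-- At a fixed point of the neighbour function, the population does not change. -/
theorem gks_single_of_fixed (h : IsOneKetSparse ν a a' b A) {x : Fin N} (hx : ν x = x) :
    gks A (Matrix.single x x 1) = 0 := by
  ext i j
  rw [h.gks_entry, sum_diag]
  by_cases hij : i = x ∧ j = x
  · rw [hij.1, hij.2]
    have := h.a_eq x
    rw [hx] at this
    rw [this, decayRate, if_pos hx]
    simp; ring
  · rw [h.eq_zero, Matrix.single_apply, if_neg (by tauto)]
    · simp
    · rintro ⟨-, h1, h2⟩
      have hi : i = x := by
        rcases h2 with h2 | h2
        · exact h2.symm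
        · rw [← h.involutive i, ← h2, hx]
      rw [hi, hx] at h1
      exact hij ⟨hi, by simpa using h1⟩

theorem gks_single_self (h : IsOneKetSparse ν a a' b A) {x : Fin N} (hx : ν x ≠ x) :
    gks A (Matrix.single x x 1) =
      (2 * a x : ℂ) • (Matrix.single (ν x) (ν x) (1 : ℂ) - Matrix.single x x (1 : ℂ))
      + (2 * b x : ℂ) • (Matrix.single x (ν x) (1 : ℂ) + Matrix.single (ν x) x (1 : ℂ)) := by
  ext i j
  rw [h.gks_entry, sum_diag]
  simp only [Matrix.add_apply, Matrix.sub_apply, Matrix.smul_apply, smul_eq_mul,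
    Matrix.single_apply]
  by_cases hi : i = x
  · subst hi
    by_cases hj : j = i
    · subst hj
      rw [h.a'_eq]
      simp [hx, decayRate]; ring
    · by_cases hj' : j = ν i
      · subst hj'
        rw [h.b_self]
        simp [hx, Ne.symm hx]
      · rw [h.eq_zero (by tauto)]
        simp [hx, Ne.symm hj, Ne.symm hj']
  · by_cases hi' : i = ν x
    · subst hi'
      by_cases hj : j = x
      · subst hj
        rw [h.b_left]
        simp [hx, Ne.symm hx]
      · by_cases hj' : j = ν x
        · subst hj'
          rw [h.a_eq_swap]
          simp [Ne.symm hx]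
        · rw [h.eq_zero (by rw [h.involutive]; tauto)]
          simp [Ne.symm hx, Ne.symm hj, Ne.symm hj']
    · rw [h.eq_zero]
      · simp [Ne.symm hi, Ne.symm hi']
      · rintro ⟨-, -, h1 | h1⟩
        · exact hi h1.symm
        · exact hi' (by rw [h1, h.involutive])

theorem evolution_single_of_ne (h : IsOneKetSparse ν a a' b A) (t : ℝ) {x y : Fin N}
    (hxy : x ≠ y) : evolution (gks A) t (Matrix.single x y 1) =
      ((Real.exp (-(decayRate ν a a' x * t)) * Real.exp (-(decayRate ν a a' y * t)) : ℝ) : ℂ) •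
        Matrix.single x y (1 : ℂ) := by
  rw [evolution_of_eigenvector _ _ (h.gks_single_of_ne hxy), ← Real.exp_add]
  push_cast
  congr 2
  ring

theorem evolution_single_of_fixed (h : IsOneKetSparse ν a a' b A) (t : ℝ) {x : Fin N}
    (hx : ν x = x) : evolution (gks A) t (Matrix.single x x 1) = Matrix.single x x (1 : ℂ) := by
  have : gks A (Matrix.single x x 1) = (0 : ℂ) • Matrix.single x x (1 : ℂ) := by
    rw [h.gks_single_of_fixed hx, zero_smul]
  rw [evolution_of_eigenvector _ _ this]
  simp

/-- Populations of a pair: `|x⟩⟨x|` is a combination of three eigenvectors of the generator, with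
`D = |x⟩⟨x| - |νx⟩⟨νx|`, `X = |x⟩⟨νx| + |νx⟩⟨x|` and `|x⟩⟨x| + |νx⟩⟨νx| + (2b/(a+a')) X`. When
`a + a' = 0` the junk value of the quotient is harmless, because then `b = 0`. -/
theorem evolution_single_self (h : IsOneKetSparse ν a a' b A) (t : ℝ) {x : Fin N}
    (hx : ν x ≠ x) : evolution (gks A) t (Matrix.single x x 1) =
      (((1 + Real.exp (-(4 * a x * t))) / 2 : ℝ) : ℂ) • Matrix.single x x (1 : ℂ)
      + (((1 - Real.exp (-(4 * a x * t))) / 2 : ℝ) : ℂ) • Matrix.single (ν x) (ν x) (1 : ℂ)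
      + ((b x / (a x + a' x) * (1 - Real.exp (-(2 * (a x + a' x) * t))) : ℝ) : ℂ) •
        (Matrix.single x (ν x) (1 : ℂ) + Matrix.single (ν x) x (1 : ℂ)) := by
  set y := ν x with hy
  have hyx : ν y = x := h.involutive x
  have hLx := h.gks_single_self hx
  have hLy := h.gks_single_self (x := y) (by rw [hyx]; exact Ne.symm hx)
  rw [hyx, h.a_nbr, h.b_nbr] at hLy
  rw [← hy] at hLx
  have hγ : decayRate ν a a' x = a x + a' x := if_neg hx
  have hγ' : decayRate ν a a' y = a x + a' x := by rw [hy, h.decayRate_nbr, hγ]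
  set T := Matrix.single x x (1 : ℂ) + Matrix.single y y (1 : ℂ) with hT
  set D := Matrix.single x x (1 : ℂ) - Matrix.single y y (1 : ℂ) with hD
  set X := Matrix.single x y (1 : ℂ) + Matrix.single y x (1 : ℂ) with hX
  have hLX : gks A X = (-(2 * (a x + a' x)) : ℂ) • X := by
    rw [hX, map_add, h.gks_single_of_ne (Ne.symm hx), h.gks_single_of_ne hx, hγ, hγ', smul_add]
    push_cast
    congr 2 <;> ring
  have hLD : gks A D = (-(4 * a x) : ℂ) • D := by
    rw [hD, map_sub, hLx, hLy]
    module
  have hLT : gks A (T + (2 * b x / (a x + a' x) : ℂ) • X) =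
      (0 : ℂ) • (T + (2 * b x / (a x + a' x) : ℂ) • X) := by
    have hb : (2 * b x / (a x + a' x) : ℂ) * (2 * (a x + a' x)) = 4 * b x := by
      by_cases h0 : a x + a' x = 0
      · have h1 := h.a_nonneg x
        have h2 := h.a'_nonneg x
        have h3 : a x = 0 := by linarith
        have h4 := h.b_sq_le x
        rw [h3, zero_mul] at h4
        have h5 : b x = 0 := by nlinarith
        simp [h5]
      · have h0' : (a x + a' x : ℂ) ≠ 0 := by exact_mod_cast h0
        field_simp
        ring
    have hTX : gks A T = (4 * b x : ℂ) • X := by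
      rw [hT, map_add, hLx, hLy, hX]
      module
    rw [map_add, map_smul, hLX, hTX, zero_smul, smul_smul, ← add_smul, mul_neg, hb,
      add_neg_cancel, zero_smul]
  have key : Matrix.single x x (1 : ℂ) = (1 / 2 : ℂ) • (T + (2 * b x / (a x + a' x) : ℂ) • X)
      + (-(b x / (a x + a' x)) : ℂ) • X + (1 / 2 : ℂ) • D := by
    rw [hT, hD]
    module
  have ev := congrArg (evolution (gks A) t) key
  rw [evolution_add, evolution_add, evolution_smul, evolution_smul, evolution_smul,
    evolution_of_eigenvector _ _ hLT, evolution_of_eigenvector _ _ hLX,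
    evolution_of_eigenvector _ _ hLD] at ev
  have e1 : Complex.exp (t * (-(2 * (a x + a' x)))) =
      ((Real.exp (-(2 * (a x + a' x) * t)) : ℝ) : ℂ) := by
    push_cast; congr 1; ring
  have e2 : Complex.exp (t * (-(4 * a x))) = ((Real.exp (-(4 * a x * t)) : ℝ) : ℂ) := by
    push_cast; congr 1; ring
  rw [ev, e1, e2, hT, hD, mul_zero, Complex.exp_zero]
  simp only [Complex.ofReal_div, Complex.ofReal_mul, Complex.ofReal_sub, Complex.ofReal_add,
    Complex.ofReal_one, Complex.ofReal_ofNat]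
  module

end IsOneKetSparse
end Lindblad

/-! ### Gates -/

section Gates

variable {N m : ℕ} {O : Oracle N}

/-- The computational basis vector `|w⟩|z⟩`. -/
def ket (w : Wire N m → Bool) (z : Coeffs) : State N m := Finsupp.single (w, z) 1

theorem single_eq_smul_ket (w : Wire N m → Bool) (z : Coeffs) (c : ℂ) :
    (Finsupp.single (w, z) c : State N m) = c • ket w z := by
  simp [ket]

theorem run_append (P P' : Circuit N m) (ψ : State N m) :
    run O (P ++ P') ψ = run O P' (run O P ψ) := List.foldl_append

theorem run_add (P : Circuit N m) (ψ φ : State N m) :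
    run O P (ψ + φ) = run O P ψ + run O P φ := by
  induction P generalizing ψ φ with
  | nil => rfl
  | cons s P ih => simpa [run] using ih (s.apply O ψ) (s.apply O φ)

theorem run_smul (P : Circuit N m) (c : ℂ) (ψ : State N m) :
    run O P (c • ψ) = c • run O P ψ := by
  induction P generalizing ψ with
  | nil => rfl
  | cons s P ih => simpa [run] using ih (s.apply O ψ)

theorem run_sum {ι : Type*} (P : Circuit N m) (s : Finset ι) (ψ : ι → State N m) :
    run O P (∑ i ∈ s, ψ i) = ∑ i ∈ s, run O P (ψ i) :=
  map_sum (AddMonoidHom.mk' (run O P) (run_add P)) ψ s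

theorem gateCount_append (P P' : Circuit N m) :
    gateCount (P ++ P') = gateCount P + gateCount P' := by
  induction P with
  | nil => simp [gateCount]
  | cons s P ih => cases s <;> (simp [gateCount, ih]; try omega)

theorem queryCount_append (P P' : Circuit N m) :
    queryCount (P ++ P') = queryCount P + queryCount P' := by
  induction P with
  | nil => simp [queryCount]
  | cons s P ih => cases s <;> (simp [queryCount, ih]; try omega)

/-- The two-qubit gate that applies `V c` to the second qubit if the first one holds `c`. -/
def controlled (V : Bool → Matrix.unitaryGroup Bool ℂ) : Matrix.unitaryGroup (Bool × Bool) ℂ :=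
  ⟨Matrix.of fun p q => if p.1 = q.1 then V q.1 p.2 q.2 else 0, by
    have hV : ∀ c i j, ∑ k, V c i k * star (V c j k) = if i = j then 1 else 0 := fun c i j => by
      have := congrFun (congrFun (Matrix.mem_unitaryGroup_iff.1 (V c).2) i) j
      simpa only [Matrix.mul_apply, Matrix.star_apply, Matrix.one_apply] using this
    rw [Matrix.mem_unitaryGroup_iff]
    ext ⟨c, i⟩ ⟨c', j⟩
    simp only [Matrix.mul_apply, Matrix.star_apply, Matrix.one_apply, Matrix.of_apply,
      Fintype.sum_prod_type, Prod.mk.injEq]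
    rw [Finset.sum_eq_single c (fun k _ hk => by simp [Ne.symm hk]) (by simp)]
    by_cases h : c = c'
    · subst h
      simpa using hV c i j
    · simp [h, Ne.symm h]⟩

/-- The step that applies `V z c` to qubit `j`, where `c` is the content of qubit `i` and `z` that
of the coefficient register. -/
def controlledStep (i j : Wire N m) (hij : i ≠ j)
    (V : Coeffs → Bool → Matrix.unitaryGroup Bool ℂ) : Step N m :=
  .gate i j hij fun z => controlled (V z)

theorem run_controlledStep {i j : Wire N m} (hij : i ≠ j)
    (V : Coeffs → Bool → Matrix.unitaryGroup Bool ℂ) (w : Wire N m → Bool) (z : Coeffs) :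
    run O [controlledStep i j hij V] (ket w z) =
      ∑ q, (V z (w i) q (w j)) • ket (Function.update w j q) z := by
  have h1 : ∀ p q, (controlled (V z) : Matrix (Bool × Bool) (Bool × Bool) ℂ) (p, q) (w i, w j) =
      if p = w i then V z (w i) q (w j) else 0 := fun p q => rfl
  simp only [run, List.foldl_cons, List.foldl_nil, Step.apply, ket, controlledStep,
    Finsupp.linearCombination_single, one_smul, Step.onBasis, h1]
  rw [Finset.sum_eq_single (w i) (fun p _ hp => by simp [hp]) (by simp)]
  refine Finset.sum_congr rfl fun q _ => ?_
  rw [if_pos rfl, Function.update_eq_self, single_eq_smul_ket, ket]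

/-- The bit flip. -/
def flipGate : Matrix.unitaryGroup Bool ℂ :=
  ⟨Matrix.of fun p q => if p = q then 0 else 1, by
    rw [Matrix.mem_unitaryGroup_iff]
    ext i j
    cases i <;> cases j <;> simp [Matrix.mul_apply]⟩

/-- A square root of the bit flip. -/
def sqrtFlip : Matrix.unitaryGroup Bool ℂ :=
  ⟨Matrix.of fun p q => if p = q then (1 + Complex.I) / 2 else (1 - Complex.I) / 2, by
    rw [Matrix.mem_unitaryGroup_iff]
    ext i j
    cases i <;> cases j <;> simp [Matrix.mul_apply, map_ofNat] <;> ring_nf <;> simp <;> norm_num⟩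

/-- The rotation by the angle `θ`. -/
def rotation (θ : ℝ) : Matrix.unitaryGroup Bool ℂ :=
  ⟨Matrix.of fun p q => if p = q then (Real.cos θ : ℂ) else
      if p then (Real.sin θ : ℂ) else -(Real.sin θ : ℂ), by
    have h : (Real.cos θ : ℂ) * Real.cos θ + Real.sin θ * Real.sin θ = 1 := by
      have := Real.cos_sq_add_sin_sq θ
      rw [sq, sq] at this
      exact_mod_cast this
    rw [Matrix.mem_unitaryGroup_iff]
    ext i j
    cases i <;> cases j <;>
      simp only [Matrix.mul_apply, Matrix.of_apply, Matrix.star_apply, Fintype.sum_bool,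
        Matrix.one_apply, if_true, if_false, Bool.false_eq_true, reduceCtorEq,
        RCLike.star_def, Complex.conj_ofReal, map_neg]
    · linear_combination h
    · ring
    · ring
    · linear_combination h⟩

/-- The controlled bit flip. -/
def cnotStep (i j : Wire N m) (hij : i ≠ j) : Step N m :=
  controlledStep i j hij fun _ c => if c then flipGate else 1

theorem run_cnotStep {i j : Wire N m} (hij : i ≠ j) (w : Wire N m → Bool) (z : Coeffs) :
    run O [cnotStep i j hij] (ket w z) = ket (Function.update w j (w j ^^ w i)) z := by
  rw [cnotStep, run_controlledStep, Fintype.sum_bool]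
  cases w i <;> cases w j <;> simp [flipGate]

/-- The circuit `P` acts on qubit `t` by the matrix `M` when the other qubits are as in `w`. -/
def ActsAt (O : Oracle N) (P : Circuit N m) (t : Wire N m) (w : Wire N m → Bool) (z : Coeffs)
    (M : Matrix Bool Bool ℂ) : Prop :=
  ∀ q, run O P (ket (Function.update w t q) z) = ∑ p, M p q • ket (Function.update w t p) z

theorem ActsAt.append {P P' : Circuit N m} {t : Wire N m} {w : Wire N m → Bool} {z : Coeffs}
    {M M' : Matrix Bool Bool ℂ} (h : ActsAt O P t w z M) (h' : ActsAt O P' t w z M') :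
    ActsAt O (P ++ P') t w z (M' * M) := by
  intro q
  rw [run_append, h q]
  simp only [Fintype.sum_bool, run_add, run_smul, h' _, Matrix.mul_apply]
  module

theorem actsAt_controlledStep {i t : Wire N m} (hit : i ≠ t)
    (V : Coeffs → Bool → Matrix.unitaryGroup Bool ℂ) (w : Wire N m → Bool) (z : Coeffs) :
    ActsAt O [controlledStep i t hit V] t w z (V z (w i)) := by
  intro q
  rw [run_controlledStep]
  simp [Function.update_of_ne hit]

/-- Flips qubit `t` if both `a` and `b` hold: with `V² = X`, the exponent of
`V^b V^{-(a ⊕ b)} V^a` is `a + b - (a ⊕ b) = 2ab`. -/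
def toffoli (a b t : Wire N m) (hab : a ≠ b) (hat : a ≠ t) (hbt : b ≠ t) : Circuit N m :=
  [controlledStep b t hbt fun _ c => if c then sqrtFlip else 1] ++
    (([cnotStep a b hab] ++ [controlledStep b t hbt fun _ c => if c then sqrtFlip⁻¹ else 1] ++
      [cnotStep a b hab]) ++
    [controlledStep a t hat fun _ c => if c then sqrtFlip else 1])

theorem run_toffoli {a b t : Wire N m} (hab : a ≠ b) (hat : a ≠ t) (hbt : b ≠ t)
    (w : Wire N m → Bool) (z : Coeffs) :
    run O (toffoli a b t hab hat hbt) (ket w z) =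
      ket (Function.update w t (w t ^^ (w a && w b))) z := by
  have h1 : ActsAt O ([cnotStep a b hab] ++
      [controlledStep b t hbt fun _ c => if c then sqrtFlip⁻¹ else 1] ++ [cnotStep a b hab]) t w z
      ((if w b ^^ w a then sqrtFlip⁻¹ else 1 : Matrix.unitaryGroup Bool ℂ)) := by
    intro q
    have hb : Function.update (Function.update w t q) b (w b ^^ w a) =
        Function.update (Function.update w b (w b ^^ w a)) t q :=
      Function.update_comm hbt.symm _ _ _
    have hb' : ∀ p, Function.update (Function.update w t p) b (w b) = Function.update w t p :=
      fun p => by rw [Function.update_comm hbt.symm, Function.update_eq_self]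
    rw [run_append, run_append, run_cnotStep, Function.update_of_ne hbt,
      Function.update_of_ne hat, hb, actsAt_controlledStep hbt _ _ _ q]
    simp only [Fintype.sum_bool, run_add, run_smul, run_cnotStep, Function.update_of_ne hbt,
      Function.update_of_ne hat, Function.update_of_ne hab, Function.update_self]
    simp only [Function.update_comm hbt, Function.update_idem, Bool.xor_assoc, Bool.xor_self,
      Bool.xor_false, hb']
  have h2 := (actsAt_controlledStep hbt (fun _ c => if c then sqrtFlip else 1) w z).append
    (h1.append (actsAt_controlledStep (O := O) hat (fun _ c => if c then sqrtFlip else 1) w z))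
      (w t)
  rw [Function.update_eq_self] at h2
  rw [toffoli, h2, Fintype.sum_bool]
  have hsq : (sqrtFlip : Matrix Bool Bool ℂ) * sqrtFlip = flipGate := by
    ext i j
    cases i <;> cases j <;> simp [Matrix.mul_apply, sqrtFlip, flipGate] <;> ring_nf <;> simp <;>
      norm_num
  have hinv : ((sqrtFlip⁻¹ : Matrix.unitaryGroup Bool ℂ) : Matrix Bool Bool ℂ) * sqrtFlip = 1 := by
    rw [← Matrix.UnitaryGroup.mul_val, inv_mul_cancel, Matrix.UnitaryGroup.one_val]
  have hinv' : (sqrtFlip : Matrix Bool Bool ℂ) * (sqrtFlip⁻¹ : Matrix.unitaryGroup Bool ℂ) = 1 := by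
    rw [← Matrix.UnitaryGroup.mul_val, mul_inv_cancel, Matrix.UnitaryGroup.one_val]
  have hk : ∀ c, w t = c → Function.update w t c = w := fun c hc => by
    rw [← hc, Function.update_eq_self]
  -- In the four cases the product is `1`, `V⁻¹ V`, `V V⁻¹` and `V V`.
  cases w a <;> cases w b <;> simp [hsq, hinv, hinv'] <;> cases ht : w t <;>
    simp [flipGate, hk _ ht]

/-! ### Reversible circuits -/

/-- Operations that permute the computational basis states. -/
inductive RevOp (N m : ℕ) where
  | cnot (i j : Wire N m) (hij : i ≠ j)
  | toffoli (a b t : Wire N m) (hab : a ≠ b) (hat : a ≠ t) (hbt : b ≠ t)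
  | query (inp out : Fin (width N) ↪ Wire N m) (hdisj : ∀ k l, inp k ≠ out l) (inv : Bool)

namespace RevOp

/-- The circuit that performs an operation. -/
def circuit : RevOp N m → Circuit N m
  | cnot i j hij => [cnotStep i j hij]
  | toffoli a b t hab hat hbt => OneKet.toffoli a b t hab hat hbt
  | query inp out hdisj inv => [.query inp out hdisj inv]

/-- The inverse operation. -/
def inverse : RevOp N m → RevOp N m
  | query inp out hdisj inv => query inp out hdisj !inv
  | op => op

open Classical in
/-- The permutation of the basis states that an operation performs. -/
def act (O : Oracle N) : RevOp N m → BasisState N m → BasisState N m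
  | cnot i j _, s => (Function.update s.1 j (s.1 j ^^ s.1 i), s.2)
  | toffoli a b t _ _ _, s => (Function.update s.1 t (s.1 t ^^ (s.1 a && s.1 b)), s.2)
  | query inp out _ inv, s =>
      if h : ∃ x : Fin N, encode x = s.1 ∘ inp then
        (xorAt out (encode (O.nbr h.choose)) s.1,
          if inv then s.2 - O.coeffs h.choose else s.2 + O.coeffs h.choose)
      else s

theorem run_circuit (op : RevOp N m) (s : BasisState N m) :
    run O op.circuit (ket s.1 s.2) = ket (op.act O s).1 (op.act O s).2 := by
  cases op with
  | cnot i j hij => exact run_cnotStep hij _ _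
  | toffoli a b t hab hat hbt => exact run_toffoli hab hat hbt _ _
  | query inp out hdisj inv =>
    simp only [run, circuit, List.foldl_cons, List.foldl_nil, Step.apply, ket,
      Finsupp.linearCombination_single, one_smul, Step.onBasis, act]
    split_ifs <;> rfl

theorem xorAt_comp {inp out : Fin (width N) ↪ Wire N m} (hdisj : ∀ k l, inp k ≠ out l)
    (y : Fin (width N) → Bool) (w : Wire N m → Bool) : xorAt out y w ∘ inp = w ∘ inp := by
  funext k
  have : ¬ ∃ l, out l = inp k ∧ y l = true := fun ⟨l, hl, _⟩ => hdisj k l hl.symm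
  simp [xorAt, this]

theorem xorAt_xorAt (out : Fin (width N) ↪ Wire N m) (y : Fin (width N) → Bool)
    (w : Wire N m → Bool) : xorAt out y (xorAt out y w) = w := by
  funext v
  simp [xorAt]

theorem act_query {inp out : Fin (width N) ↪ Wire N m} (hdisj : ∀ k l, inp k ≠ out l)
    (inv : Bool) {s : BasisState N m} {x : Fin N} (hx : encode x = s.1 ∘ inp) :
    (query inp out hdisj inv).act O s = (xorAt out (encode (O.nbr x)) s.1,
      if inv then s.2 - O.coeffs x else s.2 + O.coeffs x) := by
  have h : ∃ x : Fin N, encode x = s.1 ∘ inp := ⟨x, hx⟩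
  have hc : h.choose = x := encode_injective (h.choose_spec.trans hx.symm)
  rw [act, dif_pos h, hc]

theorem act_inverse (op : RevOp N m) (s : BasisState N m) : op.inverse.act O (op.act O s) = s := by
  cases op with
  | cnot i j hij => simp [inverse, act, Function.update_of_ne hij]
  | toffoli a b t hab hat hbt =>
    simp [inverse, act, Function.update_of_ne hat, Function.update_of_ne hbt]
  | query inp out hdisj inv =>
    by_cases h : ∃ x : Fin N, encode x = s.1 ∘ inp
    · obtain ⟨x, hx⟩ := h
      rw [act_query hdisj inv hx, inverse,
        act_query hdisj _ (x := x) (by rw [hx]; exact (xorAt_comp hdisj _ _).symm), xorAt_xorAt]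
      cases inv <;> simp
    · simp only [inverse, act, dif_neg h]

/-- The circuit that performs a list of operations. -/
def circuits (l : List (RevOp N m)) : Circuit N m := l.flatMap circuit

/-- The permutation of the basis states that a list of operations performs. -/
def acts (O : Oracle N) (l : List (RevOp N m)) (s : BasisState N m) : BasisState N m :=
  l.foldl (fun s op => op.act O s) s

theorem acts_append (l l' : List (RevOp N m)) (s : BasisState N m) :
    acts O (l ++ l') s = acts O l' (acts O l s) := List.foldl_append

theorem acts_cons (op : RevOp N m) (l : List (RevOp N m)) (s : BasisState N m) :
    acts O (op :: l) s = acts O l (op.act O s) := rfl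

theorem run_circuits (l : List (RevOp N m)) (s : BasisState N m) :
    run O (circuits l) (ket s.1 s.2) = ket (acts O l s).1 (acts O l s).2 := by
  induction l generalizing s with
  | nil => rfl
  | cons op l ih => rw [circuits, List.flatMap_cons, run_append, run_circuit, acts_cons]; exact ih _

/-- The operations that undo a list of operations. -/
def inverses (l : List (RevOp N m)) : List (RevOp N m) := (l.map inverse).reverse

theorem acts_inverses (l : List (RevOp N m)) (s : BasisState N m) :
    acts O (inverses l) (acts O l s) = s := by
  induction l generalizing s with
  | nil => rfl
  | cons op l ih =>
    rw [inverses, List.map_cons, List.reverse_cons, acts_append, acts_cons]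
    exact (congrArg _ (ih _)).trans (act_inverse op s)

end RevOp

end Gates

/-! ### The qubits of the simulation circuit -/

/-- Labels of the ancilla qubits: three copies of the system register and five single qubits. -/
abbrev Ancilla (N : ℕ) := Fin (width N) ⊕ Fin (width N) ⊕ Fin (width N) ⊕ Fin 5

/-- Number of ancilla qubits. -/
abbrev ancillas (N : ℕ) : ℕ := Fintype.card (Ancilla N)

/-- A classical content of all qubits. -/
@[ext]
structure Register (N : ℕ) where
  /-- the system -/
  sys : Fin (width N) → Bool
  /-- the bitwise difference of a basis state and its neighbour -/
  diff : Fin (width N) → Bool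
  /-- marks the first position where `diff` holds -/
  lead : Fin (width N) → Bool
  /-- the record of the pair in which a jump took place -/
  copy : Fin (width N) → Bool
  /-- whether the basis state differs from its neighbour -/
  move : Bool
  /-- which of the two members of its pair the basis state is -/
  side : Bool
  /-- whether a jump took place -/
  jump : Bool
  /-- whether the jump leads to the other member of the pair -/
  swap : Bool
  /-- purifies the state after a jump -/
  aux : Bool

section Wires

variable {N : ℕ}

/-- The wire of an ancilla. -/
def ancillaWire (l : Ancilla N) : Wire N (ancillas N) := Sum.inr (Fintype.equivFin _ l)

theorem ancillaWire_injective : Function.Injective (ancillaWire (N := N)) := fun _ _ h =>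
  (Fintype.equivFin _).injective (Sum.inr_injective h)

@[simp] theorem ancillaWire_inj {l l' : Ancilla N} : ancillaWire l = ancillaWire l' ↔ l = l' :=
  ancillaWire_injective.eq_iff

/-- The wires of the system register. -/
def sysWire (i : Fin (width N)) : Wire N (ancillas N) := Sum.inl i

@[simp] theorem sysWire_inj {i j : Fin (width N)} : sysWire i = sysWire j ↔ i = j :=
  Sum.inl_injective.eq_iff

@[simp] theorem sysWire_ne (i : Fin (width N)) (l : Ancilla N) : sysWire i ≠ ancillaWire l :=
  Sum.inl_ne_inr

@[simp] theorem ancillaWire_ne (i : Fin (width N)) (l : Ancilla N) : ancillaWire l ≠ sysWire i :=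
  Sum.inr_ne_inl

/-- The wires of `Register.diff`. -/
abbrev diffWire (i : Fin (width N)) : Wire N (ancillas N) := ancillaWire (.inl i)

/-- The wires of `Register.lead`. -/
abbrev leadWire (i : Fin (width N)) : Wire N (ancillas N) := ancillaWire (.inr (.inl i))

/-- The wires of `Register.copy`. -/
abbrev copyWire (i : Fin (width N)) : Wire N (ancillas N) := ancillaWire (.inr (.inr (.inl i)))

/-- The wires of the five single ancilla qubits, in the order of the fields of `Register`. -/
abbrev flagWire (c : Fin 5) : Wire N (ancillas N) := ancillaWire (.inr (.inr (.inr c)))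

theorem wire_cases (v : Wire N (ancillas N)) : (∃ i, v = sysWire i) ∨ ∃ l, v = ancillaWire l := by
  rcases v with i | j
  · exact .inl ⟨i, rfl⟩
  · exact .inr ⟨(Fintype.equivFin _).symm j, by simp [ancillaWire]⟩

end Wires

namespace Register

variable {N : ℕ} (R : Register N)

/-- The content of the ancilla qubits. -/
def anc : Ancilla N → Bool :=
  Sum.elim R.diff (Sum.elim R.lead (Sum.elim R.copy ![R.move, R.side, R.jump, R.swap, R.aux]))

/-- The bit assignment that a register content stands for. -/
def bits : Wire N (ancillas N) → Bool :=
  Sum.elim R.sys fun j => R.anc ((Fintype.equivFin _).symm j)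

@[simp] theorem bits_sys (i : Fin (width N)) : R.bits (sysWire i) = R.sys i := rfl

theorem bits_anc (l : Ancilla N) : R.bits (ancillaWire l) = R.anc l := by
  simp [bits, ancillaWire]

@[simp] theorem bits_diff (i : Fin (width N)) : R.bits (diffWire i) = R.diff i := by
  simp [bits_anc, anc]

@[simp] theorem bits_lead (i : Fin (width N)) : R.bits (leadWire i) = R.lead i := by
  simp [bits_anc, anc]

@[simp] theorem bits_copy (i : Fin (width N)) : R.bits (copyWire i) = R.copy i := by
  simp [bits_anc, anc]

@[simp] theorem bits_move : R.bits (flagWire 0) = R.move := by simp [bits_anc, anc]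
@[simp] theorem bits_side : R.bits (flagWire 1) = R.side := by simp [bits_anc, anc]
@[simp] theorem bits_jump : R.bits (flagWire 2) = R.jump := by simp [bits_anc, anc]
@[simp] theorem bits_swap : R.bits (flagWire 3) = R.swap := by simp [bits_anc, anc]
@[simp] theorem bits_aux : R.bits (flagWire 4) = R.aux := by simp [bits_anc, anc]

theorem bits_eq {R : Register N} {w : Wire N (ancillas N) → Bool}
    (h : ∀ i, w (sysWire i) = R.sys i) (h' : ∀ l, w (ancillaWire l) = R.anc l) : w = R.bits := by
  funext v
  rcases wire_cases v with ⟨i, rfl⟩ | ⟨l, rfl⟩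
  · exact h i
  · rw [h', bits_anc]

@[simp] theorem update_sys (i : Fin (width N)) (c : Bool) :
    Function.update R.bits (sysWire i) c = {R with sys := Function.update R.sys i c}.bits := by
  refine bits_eq (fun j => ?_) fun l => ?_
  · by_cases h : j = i
    · subst h; simp
    · simp [h]
  · simp [bits_anc, anc]

theorem update_anc {R' : Register N} (l : Ancilla N) (c : Bool) (hs : R'.sys = R.sys)
    (h : R'.anc = Function.update R.anc l c) :
    Function.update R.bits (ancillaWire l) c = R'.bits := by
  refine bits_eq (fun j => by simp [hs]) fun l' => ?_
  by_cases hl : l' = l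
  · subst hl; simp [h]
  · simp [h, hl, bits_anc]

@[simp] theorem update_diff (i : Fin (width N)) (c : Bool) :
    Function.update R.bits (diffWire i) c = {R with diff := Function.update R.diff i c}.bits := by
  refine R.update_anc _ _ rfl ?_
  simp only [anc, Sum.update_elim_inl]

@[simp] theorem update_lead (i : Fin (width N)) (c : Bool) :
    Function.update R.bits (leadWire i) c = {R with lead := Function.update R.lead i c}.bits := by
  refine R.update_anc _ _ rfl ?_
  simp only [anc, Sum.update_elim_inl, Sum.update_elim_inr]

@[simp] theorem update_copy (i : Fin (width N)) (c : Bool) :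
    Function.update R.bits (copyWire i) c = {R with copy := Function.update R.copy i c}.bits := by
  refine R.update_anc _ _ rfl ?_
  simp only [anc, Sum.update_elim_inl, Sum.update_elim_inr]

@[simp] theorem update_move (c : Bool) :
    Function.update R.bits (flagWire 0) c = {R with move := c}.bits := by
  refine R.update_anc _ _ rfl ?_
  simp only [anc, Sum.update_elim_inr]
  congr 3
  funext j; fin_cases j <;> rfl

@[simp] theorem update_side (c : Bool) :
    Function.update R.bits (flagWire 1) c = {R with side := c}.bits := by
  refine R.update_anc _ _ rfl ?_
  simp only [anc, Sum.update_elim_inr]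
  congr 3
  funext j; fin_cases j <;> rfl

@[simp] theorem update_jump (c : Bool) :
    Function.update R.bits (flagWire 2) c = {R with jump := c}.bits := by
  refine R.update_anc _ _ rfl ?_
  simp only [anc, Sum.update_elim_inr]
  congr 3
  funext j; fin_cases j <;> rfl

@[simp] theorem update_swap (c : Bool) :
    Function.update R.bits (flagWire 3) c = {R with swap := c}.bits := by
  refine R.update_anc _ _ rfl ?_
  simp only [anc, Sum.update_elim_inr]
  congr 3
  funext j; fin_cases j <;> rfl

@[simp] theorem update_aux (c : Bool) :
    Function.update R.bits (flagWire 4) c = {R with aux := c}.bits := by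
  refine R.update_anc _ _ rfl ?_
  simp only [anc, Sum.update_elim_inr]
  congr 3
  funext j; fin_cases j <;> rfl

/-! ### Splitting a basis state into its pair and its side -/

/-- One step of the search for the first position where `diff` holds; when it is found, `side`
receives the bit of the system there. -/
def scanStep (R : Register N) (i : Fin (width N)) : Register N :=
  let c := R.lead i ^^ (!R.move && R.diff i)
  {R with
    lead := Function.update R.lead i c
    move := R.move ^^ c
    side := R.side ^^ (c && R.sys i)}

/-- The search along a list of positions. -/
def scan (R : Register N) (l : List (Fin (width N))) : Register N := l.foldl scanStep R

/-- Moves the system to the other member of its pair if `side` is set. -/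
def canonicalize : Register N :=
  {R with sys := fun i => R.sys i ^^ (R.side && R.diff i)}

/-- Moves the system to the other member of its pair if `c` is set, and accounts for the effect that
this has on `side`. -/
def twist (c d : Bool) : Register N :=
  {R with
    sys := fun i => R.sys i ^^ (c && R.diff i)
    side := R.side ^^ (c && R.move) ^^ d}

/-- Replaces the qubits on which the preparation does not act. -/
def setEnv (u : Fin (width N) → Bool) (j s e : Bool) : Register N :=
  {R with copy := u, jump := j, swap := s, aux := e}

theorem setEnv_self {R : Register N} {u : Fin (width N) → Bool} {j s e : Bool} (hu : R.copy = u)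
    (hj : R.jump = j) (hs : R.swap = s) (he : R.aux = e) : R.setEnv u j s e = R := by
  subst hu hj hs he
  rfl

/-- A step of the search commutes with `twist`. When the step finds the first position where `diff`
holds, moving the system changes the bit that `side` receives, and `move` becomes set. A position
that is already marked would spoil this, hence the hypothesis. -/
theorem scanStep_twist (c d : Bool) (i : Fin (width N)) (h : R.lead i = false) :
    (R.twist c d).scanStep i = (R.scanStep i).twist c d := by
  simp only [scanStep, twist, h, Register.mk.injEq, true_and, and_true]
  cases R.move <;> cases R.diff i <;> cases R.side <;> cases R.sys i <;> cases c <;> cases d <;> rfl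

theorem scan_twist (c d : Bool) {l : List (Fin (width N))} (hl : l.Nodup)
    (h : ∀ i ∈ l, R.lead i = false) : (R.twist c d).scan l = (R.scan l).twist c d := by
  induction l generalizing R with
  | nil => rfl
  | cons i l ih =>
    rw [List.nodup_cons] at hl
    have := ih (R.scanStep i) hl.2 fun j hj => by
      have : j ≠ i := fun e => hl.1 (e ▸ hj)
      simpa [scanStep, this] using h j (List.mem_cons_of_mem _ hj)
    simp only [scan, List.foldl_cons] at this ⊢
    rw [scanStep_twist _ _ _ _ (h i List.mem_cons_self), this]

theorem scan_setEnv (u : Fin (width N) → Bool) (j s e : Bool) (l : List (Fin (width N))) :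
    (R.setEnv u j s e).scan l = (R.scan l).setEnv u j s e := by
  induction l generalizing R with
  | nil => rfl
  | cons i l ih => exact ih (R.scanStep i)

theorem scan_frame (l : List (Fin (width N))) :
    (R.scan l).sys = R.sys ∧ (R.scan l).diff = R.diff ∧ (R.scan l).copy = R.copy ∧
      (R.scan l).jump = R.jump ∧ (R.scan l).swap = R.swap ∧ (R.scan l).aux = R.aux := by
  induction l generalizing R with
  | nil => simp [scan]
  | cons i l ih => exact ih (R.scanStep i)

theorem scan_move {l : List (Fin (width N))} (hl : l.Nodup) (h : ∀ i ∈ l, R.lead i = false) :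
    (R.scan l).move = true ↔ R.move = true ∨ ∃ i ∈ l, R.diff i = true := by
  induction l generalizing R with
  | nil => simp [scan]
  | cons i l ih =>
    rw [List.nodup_cons] at hl
    have := ih (R.scanStep i) hl.2 fun j hj => by
      have : j ≠ i := fun e => hl.1 (e ▸ hj)
      simpa [scanStep, this] using h j (List.mem_cons_of_mem _ hj)
    refine this.trans ?_
    have h1 : (R.scanStep i).move = (R.move || R.diff i) := by
      simp only [scanStep, h i List.mem_cons_self]
      cases R.move <;> cases R.diff i <;> rfl
    simp only [h1, Bool.or_eq_true, List.mem_cons, exists_eq_or_imp, or_assoc]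
    rfl

end Register

namespace Register

variable {N : ℕ}

/-- The content of the qubits when the system is in the basis state `x` and only `side` and the
qubits on which the preparation does not act may be set. -/
def start (x : Fin N) (d : Bool) : Register N :=
  {sys := encode x, diff := fun _ => false, lead := fun _ => false, copy := fun _ => false,
    move := false, side := d, jump := false, swap := false, aux := false}

theorem start_setEnv (x : Fin N) (d : Bool) :
    (start x d).setEnv (fun _ => false) false false false = start x d := rfl

/-- The start content after the neighbour of the system has been compared with the system. -/
def compared (ν : Fin N → Fin N) (x : Fin N) (d : Bool) : Register N :=
  {start x d with diff := fun i => encode (ν x) i ^^ encode x i}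

/-- The content of the qubits after the preparation. -/
def prepared (ν : Fin N → Fin N) (x : Fin N) (d : Bool) : Register N :=
  ((compared ν x d).scan (List.finRange _)).canonicalize

/-- The basis state `x` or its neighbour. -/
def hop (ν : Fin N → Fin N) (x : Fin N) (c : Bool) : Fin N := if c then ν x else x

/-- Starting from the neighbour instead of `x` changes only `side` in the prepared content. At a
fixed point there is no neighbour to move to, and the change of `side` is inherited from the start
content, where `side` is then set. -/
theorem prepared_hop {ν : Fin N → Fin N} (hν : Function.Involutive ν) (x : Fin N) (c : Bool) :
    prepared ν (hop ν x c) (c && !(prepared ν x false).move) =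
      {prepared ν x false with side := (prepared ν x false).side ^^ c} := by
  set d := c && !(prepared ν x false).move with hd
  have h1 : compared ν (hop ν x c) d = (compared ν x false).twist c d := by
    cases c
    · simp [compared, start, hop, twist, hd]
    · simp only [compared, start, hop, twist, if_true, hν x, Bool.true_and, Register.mk.injEq,
        true_and, and_true]
      refine ⟨?_, ?_, by simp⟩ <;> funext i <;>
        cases encode x i <;> cases encode (ν x) i <;> rfl
  rw [prepared, h1, scan_twist _ _ _ (List.nodup_finRange _) fun _ _ => rfl, hd]
  simp only [prepared, canonicalize, twist, Register.mk.injEq, true_and, and_true]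
  refine ⟨?_, ?_⟩
  · funext i
    cases ((compared ν x false).scan (List.finRange _)).side <;>
    cases ((compared ν x false).scan (List.finRange _)).move <;>
    cases ((compared ν x false).scan (List.finRange _)).diff i <;>
    cases ((compared ν x false).scan (List.finRange _)).sys i <;> cases c <;> rfl
  · cases ((compared ν x false).scan (List.finRange _)).side <;>
    cases ((compared ν x false).scan (List.finRange _)).move <;> cases c <;> rfl

theorem prepared_move (ν : Fin N → Fin N) (x : Fin N) :
    (prepared ν x false).move = decide (ν x ≠ x) := by
  have h : (prepared ν x false).move = true ↔ ν x ≠ x := by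
    refine (scan_move _ (List.nodup_finRange _) fun _ _ => rfl).trans ?_
    rw [← encode_injective.ne_iff, Function.ne_iff]
    simp [compared, start]
  by_cases hx : ν x = x
  · simpa [hx] using h
  · simpa [hx] using h

theorem prepared_sys (ν : Fin N → Fin N) (x : Fin N) :
    (prepared ν x false).sys = encode (hop ν x (prepared ν x false).side) := by
  obtain ⟨h1, h2, -⟩ := (compared ν x false).scan_frame (List.finRange _)
  simp only [prepared, canonicalize, h1, h2]
  funext i
  cases ((compared ν x false).scan (List.finRange _)).side <;>
    simp [compared, start, hop, Bool.xor_comm (encode (ν x) i)]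

theorem prepared_env (ν : Fin N → Fin N) (x : Fin N) :
    (prepared ν x false).copy = (fun _ => false) ∧ (prepared ν x false).jump = false ∧
      (prepared ν x false).swap = false ∧ (prepared ν x false).aux = false :=
  ((compared ν x false).scan_frame (List.finRange _)).2.2

theorem prepared_setEnv (ν : Fin N → Fin N) (x : Fin N) (d : Bool) (u : Fin (width N) → Bool)
    (j s e : Bool) : (((compared ν x d).setEnv u j s e).scan (List.finRange _)).canonicalize =
      (prepared ν x d).setEnv u j s e := by
  rw [scan_setEnv]
  rfl

/-- The side of a basis state and the canonical member of its pair determine the basis state. -/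
theorem eq_of_prepared_eq {ν : Fin N → Fin N} (hν : Function.Involutive ν) {x y : Fin N}
    (hsys : (prepared ν x false).sys = (prepared ν y false).sys)
    (hside : (prepared ν x false).side = (prepared ν y false).side) : x = y := by
  have h := hsys
  rw [prepared_sys, prepared_sys, hside] at h
  have h' := encode_injective h
  cases hs : (prepared ν y false).side
  · simpa [hop, hs] using h'
  · exact hν.injective (by simpa [hop, hs] using h')

end Register

/-! ### The simulation circuit -/

section Circuit

variable {N : ℕ}

open RevOp

/-- The wires of the system register, as the input register of a query. -/
def sysEmb : Fin (width N) ↪ Wire N (ancillas N) := ⟨sysWire, fun _ _ h => sysWire_inj.1 h⟩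

/-- The wires of `Register.diff`, as the output register of a query. -/
def diffEmb : Fin (width N) ↪ Wire N (ancillas N) :=
  ⟨diffWire, fun _ _ h => Sum.inl_injective (ancillaWire_inj.1 h)⟩

@[simp] theorem sysEmb_apply (i : Fin (width N)) : sysEmb i = sysWire i := rfl

@[simp] theorem diffEmb_apply (i : Fin (width N)) : diffEmb i = diffWire i := rfl

theorem sysEmb_ne_diffEmb (k l : Fin (width N)) : sysEmb k ≠ diffEmb l := sysWire_ne k _

/-- The operations of `Register.scanStep`. -/
def scanOps (i : Fin (width N)) : List (RevOp N (ancillas N)) :=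
  [.toffoli (flagWire 0) (diffWire i) (leadWire i) (by simp) (by simp) (by simp),
    .cnot (diffWire i) (leadWire i) (by simp),
    .cnot (leadWire i) (flagWire 0) (by simp),
    .toffoli (leadWire i) (sysWire i) (flagWire 1) (by simp) (by simp) (by simp)]

/-- The operations of `Register.canonicalize`. -/
def canonicalizeOps : List (RevOp N (ancillas N)) :=
  (List.finRange (width N)).map fun i =>
    .toffoli (flagWire 1) (diffWire i) (sysWire i) (by simp) (by simp) (by simp)

/-- The bitwise comparison of the system with its neighbour. -/
def compareOps : List (RevOp N (ancillas N)) :=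
  (List.finRange (width N)).map fun i => .cnot (sysWire i) (diffWire i) (by simp)

/-- The preparation, which splits a basis state into its pair and its side. -/
def prepareOps : List (RevOp N (ancillas N)) :=
  .query sysEmb diffEmb sysEmb_ne_diffEmb false ::
    (compareOps ++ ((List.finRange (width N)).flatMap scanOps ++ canonicalizeOps))

/-- Records the system register in `Register.copy` if `jump` is set. -/
def recordOps : List (RevOp N (ancillas N)) :=
  (List.finRange (width N)).map fun i =>
    .toffoli (flagWire 2) (sysWire i) (copyWire i) (by simp) (by simp) (by simp)

variable {O : Oracle N}

theorem act_toffoli_bits (R : Register N) (z : Coeffs) {a b t : Wire N (ancillas N)}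
    (hab : a ≠ b) (hat : a ≠ t) (hbt : b ≠ t) :
    (RevOp.toffoli a b t hab hat hbt).act O (R.bits, z) =
      (Function.update R.bits t (R.bits t ^^ (R.bits a && R.bits b)), z) := rfl

theorem act_cnot_bits (R : Register N) (z : Coeffs) {i j : Wire N (ancillas N)} (hij : i ≠ j) :
    (RevOp.cnot i j hij).act O (R.bits, z) =
      (Function.update R.bits j (R.bits j ^^ R.bits i), z) := rfl

theorem acts_scanOps (R : Register N) (z : Coeffs) (i : Fin (width N)) :
    acts O (scanOps i) (R.bits, z) = ((R.scanStep i).bits, z) := by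
  simp only [scanOps, acts_cons, act_toffoli_bits, act_cnot_bits, Register.bits_lead,
    Register.bits_move, Register.bits_diff, Register.update_lead, Register.update_move,
    Register.bits_side, Register.bits_sys, Register.update_side, Function.update_self,
    Function.update_idem]
  have h : ((R.lead i ^^ (R.move && R.diff i)) ^^ R.diff i) =
      (R.lead i ^^ (!R.move && R.diff i)) := by
    cases R.lead i <;> cases R.move <;> cases R.diff i <;> rfl
  rw [h]
  rfl

theorem acts_scan (R : Register N) (z : Coeffs) (l : List (Fin (width N))) :
    acts O (l.flatMap scanOps) (R.bits, z) = ((R.scan l).bits, z) := by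
  induction l generalizing R with
  | nil => rfl
  | cons i l ih => rw [List.flatMap_cons, acts_append, acts_scanOps]; exact ih _

/-- Operations that modify one bit of a family each modify the family pointwise. -/
theorem acts_map_pointwise (ops : Fin (width N) → RevOp N (ancillas N)) (z : Coeffs)
    (get : (Fin (width N) → Bool) → Register N) (g : Fin (width N) → Bool → Bool)
    (h : ∀ v i, (ops i).act O ((get v).bits, z) =
      ((get (Function.update v i (g i (v i)))).bits, z)) (v : Fin (width N) → Bool) :
    acts O ((List.finRange (width N)).map ops) ((get v).bits, z) =
      ((get fun i => g i (v i)).bits, z) := by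
  have key : ∀ (l : List (Fin (width N))), l.Nodup → ∀ v : Fin (width N) → Bool,
      acts O (l.map ops) ((get v).bits, z) =
        ((get fun i => if i ∈ l then g i (v i) else v i).bits, z) := by
    intro l
    induction l with
    | nil => intro _ v; simp [acts]
    | cons i l ih =>
      intro hl v
      rw [List.nodup_cons] at hl
      rw [List.map_cons, acts_cons, h, ih hl.2]
      congr 3
      funext j
      by_cases hj : j = i
      · subst hj; simp [hl.1]
      · simp [hj]
  rw [key _ (List.nodup_finRange _)]
  simp

theorem acts_compareOps (R : Register N) (z : Coeffs) :
    acts O compareOps (R.bits, z) =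
      ({R with diff := fun i => R.diff i ^^ R.sys i}.bits, z) :=
  acts_map_pointwise _ z (fun v => {R with diff := v}) (fun i c => c ^^ R.sys i)
    (fun v i => by simp [act_cnot_bits]) R.diff

theorem acts_canonicalizeOps (R : Register N) (z : Coeffs) :
    acts O canonicalizeOps (R.bits, z) = (R.canonicalize.bits, z) :=
  acts_map_pointwise _ z (fun v => {R with sys := v}) (fun i c => c ^^ (R.side && R.diff i))
    (fun v i => by simp [act_toffoli_bits]) R.sys

theorem acts_recordOps (R : Register N) (z : Coeffs) :
    acts O recordOps (R.bits, z) =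
      ({R with copy := fun i => R.copy i ^^ (R.jump && R.sys i)}.bits, z) :=
  acts_map_pointwise _ z (fun v => {R with copy := v}) (fun i c => c ^^ (R.jump && R.sys i))
    (fun v i => by simp [act_toffoli_bits]) R.copy

theorem xorAt_diffEmb (R : Register N) (y : Fin (width N) → Bool) :
    xorAt diffEmb y R.bits = {R with diff := fun i => R.diff i ^^ y i}.bits := by
  refine Register.bits_eq (fun i => ?_) fun l => ?_
  · simp [xorAt]
  · rcases l with i | l
    · simp [xorAt, Register.bits_anc, Register.anc]
    · simp [xorAt, Register.bits_anc, Register.anc]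

theorem acts_prepareOps (x : Fin N) (d : Bool) (u : Fin (width N) → Bool) (j s e : Bool) :
    acts O prepareOps (((Register.start x d).setEnv u j s e).bits, 0) =
      (((Register.prepared O.nbr x d).setEnv u j s e).bits, O.coeffs x) := by
  rw [prepareOps, acts_cons, act_query (x := x) _ _ rfl, xorAt_diffEmb]
  rw [acts_append, acts_append, acts_compareOps, acts_scan, acts_canonicalizeOps,
    ← Register.prepared_setEnv]
  simp [Register.setEnv, Register.start, Register.compared]

/-- Undoing the preparation after a change of the side puts the system into the state on that
side. -/
theorem acts_inverses_prepareOps (hν : Function.Involutive O.nbr)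
    (hc : ∀ x, O.coeffs (O.nbr x) = O.coeffs x) (x : Fin N) (c : Bool)
    (u : Fin (width N) → Bool) (j s e : Bool) :
    acts O (inverses prepareOps)
      ((({Register.prepared O.nbr x false with
        side := (Register.prepared O.nbr x false).side ^^ c} : Register N).setEnv u j s e).bits,
        O.coeffs x) =
      (((Register.start (Register.hop O.nbr x c)
        (c && !(Register.prepared O.nbr x false).move)).setEnv u j s e).bits, 0) := by
  have h : O.coeffs (Register.hop O.nbr x c) = O.coeffs x := by
    cases c
    · rfl
    · exact hc x
  rw [← Register.prepared_hop hν, ← h, ← acts_prepareOps, acts_inverses]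

end Circuit

/-! ### The angles of the rotations -/

section Angles

/-- `1 - e^{-u}` is concave, so it lies above its chords through the origin. -/
theorem chord_le_one_sub_exp {u w : ℝ} (hu : 0 ≤ u) (huw : u ≤ w) (hw : 0 < w) :
    u / w * (1 - Real.exp (-w)) ≤ 1 - Real.exp (-u) := by
  have h := convexOn_exp.2 (Set.mem_univ (-w)) (Set.mem_univ (0 : ℝ))
    (div_nonneg hu hw.le) (sub_nonneg.2 ((div_le_one hw).2 huw)) (add_sub_cancel _ _)
  have h1 : u / w * -w + (1 - u / w) * 0 = -u := by field_simp; ring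
  simp only [smul_eq_mul, h1, Real.exp_zero] at h
  linarith

/-- The probability that a jump leads to the other member of the pair. For `a = a' = 0` there are no
jumps, and the junk value `0` is a probability as well. -/
def swapProb (t a a' : ℝ) : ℝ :=
  (1 - Real.exp (-(4 * a * t))) / (2 * (1 - Real.exp (-(2 * (a + a') * t))))

/-- The probability lies between `a / (a + a')` and `1 / 2`. -/
theorem swapProb_between {t a a' : ℝ} (ht : 0 < t) (ha : 0 ≤ a) (ha' : 0 ≤ a') (h : 0 < a + a') :
    (a / (a + a') ≤ swapProb t a a' ∧ swapProb t a a' ≤ 1 / 2) ∨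
      (1 / 2 ≤ swapProb t a a' ∧ swapProb t a a' ≤ a / (a + a')) := by
  have hw : 0 < 2 * (a + a') * t := by positivity
  have hpos : 0 < 1 - Real.exp (-(2 * (a + a') * t)) := by
    have := Real.exp_lt_one_iff.2 (neg_lt_zero.2 hw)
    linarith
  rcases le_total a a' with hle | hle
  · left
    have hle' : 4 * a * t ≤ 2 * (a + a') * t := by nlinarith
    have h1 := chord_le_one_sub_exp (by positivity) hle' hw
    have h2 : Real.exp (-(2 * (a + a') * t)) ≤ Real.exp (-(4 * a * t)) :=
      Real.exp_le_exp.2 (by linarith)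
    have h3 : 4 * a * t / (2 * (a + a') * t) = 2 * (a / (a + a')) := by field_simp; ring
    rw [h3] at h1
    constructor
    · rw [swapProb, le_div_iff₀ (by linarith)]; linarith
    · rw [swapProb, div_le_iff₀ (by linarith)]; linarith
  · right
    have ha0 : 0 < a := by linarith
    have hle' : 2 * (a + a') * t ≤ 4 * a * t := by nlinarith
    have h1 := chord_le_one_sub_exp hw.le hle' (by positivity)
    have h2 : Real.exp (-(4 * a * t)) ≤ Real.exp (-(2 * (a + a') * t)) :=
      Real.exp_le_exp.2 (by linarith)
    constructor
    · rw [swapProb, le_div_iff₀ (by linarith)]; linarith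
    · rw [swapProb, div_le_iff₀ (by linarith)]
      have h3 : a / (a + a') * (2 * (2 * (a + a') * t / (4 * a * t) *
          (1 - Real.exp (-(4 * a * t))))) = 1 - Real.exp (-(4 * a * t)) := by
        field_simp
        ring
      rw [← h3]
      gcongr

/-- The state after a jump, with populations `1 - swapProb` and `swapProb` and coherence
`b / (a + a')`, is positive semidefinite. -/
theorem swapProb_spec {t a a' b : ℝ} (ht : 0 < t) (ha : 0 ≤ a) (ha' : 0 ≤ a')
    (hb : b ^ 2 ≤ a * a') : 0 ≤ swapProb t a a' ∧ swapProb t a a' ≤ 1 ∧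
      (b / (a + a')) ^ 2 ≤ swapProb t a a' * (1 - swapProb t a a') := by
  rcases (add_nonneg ha ha').eq_or_lt' with h | h
  · have h0 : a = 0 := by linarith
    have h0' : a' = 0 := by linarith
    simp [h0, h0', swapProb]
  · have hr : a / (a + a') * (1 - a / (a + a')) = a * a' / (a + a') ^ 2 := by field_simp; ring
    have hκ : (b / (a + a')) ^ 2 ≤ a / (a + a') * (1 - a / (a + a')) := by
      rw [hr, div_pow]; gcongr
    have h0 : 0 ≤ a / (a + a') := by positivity
    have h1 : a / (a + a') ≤ 1 := (div_le_one h).2 (by linarith)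
    rcases swapProb_between ht ha ha' h with ⟨h2, h3⟩ | ⟨h2, h3⟩
    · exact ⟨by linarith, by linarith, by nlinarith⟩
    · exact ⟨by linarith, by linarith, by nlinarith⟩

/-- The rotation angle for the jump qubit; `c` tells whether the basis state differs from its
neighbour. -/
def jumpAngle (t : ℝ) (z : Coeffs) (c : Bool) : ℝ :=
  Real.arccos (Real.exp (-((if c then z.1 + z.2.1 else z.1) * t)))

/-- The rotation angle for the swap qubit. -/
def swapAngle (t : ℝ) (z : Coeffs) : ℝ := Real.arccos (√(1 - swapProb t z.1 z.2.1))

/-- The rotation angle for the purifying qubit. Its cosine reduces the coherence of the state after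
a jump from that of a pure state to `b / (a + a')`. -/
def auxAngle (t : ℝ) (z : Coeffs) : ℝ :=
  Real.arccos (z.2.2 / (z.1 + z.2.1) / (Real.sin (swapAngle t z) * Real.cos (swapAngle t z)))

theorem cos_jumpAngle {t a a' b : ℝ} (ht : 0 < t) (ha : 0 ≤ a) (ha' : 0 ≤ a') (c : Bool) :
    Real.cos (jumpAngle t (a, a', b) c) = Real.exp (-((if c then a + a' else a) * t)) := by
  refine Real.cos_arccos (by linarith [Real.exp_pos (-((if c then a + a' else a) * t))])
    (Real.exp_le_one_iff.2 (neg_nonpos.2 (mul_nonneg ?_ ht.le)))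
  split_ifs <;> positivity

theorem sin_sq_jumpAngle {t a a' b : ℝ} (ht : 0 < t) (ha : 0 ≤ a) (ha' : 0 ≤ a') :
    Real.sin (jumpAngle t (a, a', b) true) ^ 2 = 1 - Real.exp (-(2 * (a + a') * t)) := by
  rw [Real.sin_sq, cos_jumpAngle ht ha ha', sq, ← Real.exp_add]
  simp only [if_true]
  congr 2
  ring

theorem sin_sq_swapAngle {t a a' b : ℝ} (ht : 0 < t) (ha : 0 ≤ a) (ha' : 0 ≤ a')
    (hb : b ^ 2 ≤ a * a') : Real.sin (swapAngle t (a, a', b)) ^ 2 = swapProb t a a' := by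
  obtain ⟨h0, h1, -⟩ := swapProb_spec ht ha ha' hb
  have h2 : √(1 - swapProb t a a') ≤ 1 := Real.sqrt_le_one.2 (by linarith)
  have h3 := Real.sqrt_nonneg (1 - swapProb t a a')
  rw [Real.sin_sq, swapAngle, Real.cos_arccos (by linarith) h2, Real.sq_sqrt (by linarith)]
  ring

theorem cos_auxAngle {t a a' b : ℝ} (ht : 0 < t) (ha : 0 ≤ a) (ha' : 0 ≤ a')
    (hb : b ^ 2 ≤ a * a') : Real.sin (swapAngle t (a, a', b)) * Real.cos (swapAngle t (a, a', b)) *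
      Real.cos (auxAngle t (a, a', b)) = b / (a + a') := by
  obtain ⟨-, -, h⟩ := swapProb_spec ht ha ha' hb
  have hs := sin_sq_swapAngle ht ha ha' hb
  rw [← hs] at h
  have hc := Real.cos_sq' (swapAngle t (a, a', b))
  rw [← hc, ← mul_pow, sq_le_sq] at h
  set k := Real.sin (swapAngle t (a, a', b)) * Real.cos (swapAngle t (a, a', b)) with hk
  rcases eq_or_ne k 0 with h0 | h0
  · rw [h0, abs_zero] at h
    rw [h0, zero_mul, abs_nonpos_iff.1 h]
  · have h1 : |b / (a + a') / k| ≤ 1 := by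
      rw [abs_div]
      exact (div_le_one (abs_pos.2 h0)).2 h
    rw [abs_le] at h1
    rw [auxAngle, Real.cos_arccos (by simpa only [← hk] using h1.1)
      (by simpa only [← hk] using h1.2), ← hk]
    field_simp

/-- The weight that the circuit moves to the other member of the pair. -/
theorem weight_swap {t a a' b : ℝ} (ht : 0 < t) (ha : 0 ≤ a) (ha' : 0 ≤ a')
    (hb : b ^ 2 ≤ a * a') : Real.sin (jumpAngle t (a, a', b) true) ^ 2 *
      Real.sin (swapAngle t (a, a', b)) ^ 2 = (1 - Real.exp (-(4 * a * t))) / 2 := by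
  rw [sin_sq_jumpAngle ht ha ha', sin_sq_swapAngle ht ha ha' hb, swapProb]
  by_cases h : 1 - Real.exp (-(2 * (a + a') * t)) = 0
  · have h1 : Real.exp (-(2 * (a + a') * t)) = 1 := by linarith
    rw [Real.exp_eq_one_iff] at h1
    have h2 : (a + a') * t = 0 := by linarith
    have h3 : a = 0 := by
      rcases mul_eq_zero.1 h2 with h3 | h3 <;> linarith
    simp [h3]
  · field_simp

/-- The coherence that the jumps build up between the two members of the pair. -/
theorem weight_coherence {t a a' b : ℝ} (ht : 0 < t) (ha : 0 ≤ a) (ha' : 0 ≤ a')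
    (hb : b ^ 2 ≤ a * a') : Real.sin (jumpAngle t (a, a', b) true) ^ 2 *
      (Real.sin (swapAngle t (a, a', b)) * Real.cos (swapAngle t (a, a', b)) *
        Real.cos (auxAngle t (a, a', b))) =
      b / (a + a') * (1 - Real.exp (-(2 * (a + a') * t))) := by
  rw [sin_sq_jumpAngle ht ha ha', cos_auxAngle ht ha ha' hb, mul_comm]

end Angles

/-! ### The partial trace -/

section Trace

variable {N m : ℕ}

theorem traceOut_apply (ψ φ : State N m) (k l : Fin (width N) → Bool) :
    traceOut ψ φ k l = ∑ g : Fin m → Bool, ψ.sum fun s c =>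
      if s.1 = Sum.elim k g then c * star (φ (Sum.elim l g, s.2)) else 0 := rfl

theorem traceOut_add_left (ψ ψ' φ : State N m) :
    traceOut (ψ + ψ') φ = traceOut ψ φ + traceOut ψ' φ := by
  ext k l
  rw [Matrix.add_apply, traceOut_apply, traceOut_apply, traceOut_apply, ← Finset.sum_add_distrib]
  refine Finset.sum_congr rfl fun g _ => Finsupp.sum_add_index' (fun s => by simp) fun s c c' => ?_
  split_ifs <;> simp [add_mul]

theorem traceOut_smul_left (c : ℂ) (ψ φ : State N m) :
    traceOut (c • ψ) φ = c • traceOut ψ φ := by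
  ext k l
  rw [Matrix.smul_apply, traceOut_apply, traceOut_apply, Finset.smul_sum]
  refine Finset.sum_congr rfl fun g _ => ?_
  rw [Finsupp.sum_smul_index' (fun s => by simp), Finsupp.smul_sum]
  refine Finsupp.sum_congr fun s _ => ?_
  split_ifs <;> simp [mul_assoc]

theorem traceOut_add_right (ψ φ φ' : State N m) :
    traceOut ψ (φ + φ') = traceOut ψ φ + traceOut ψ φ' := by
  ext k l
  rw [Matrix.add_apply, traceOut_apply, traceOut_apply, traceOut_apply, ← Finset.sum_add_distrib]
  refine Finset.sum_congr rfl fun g _ => ?_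
  rw [← Finsupp.sum_add]
  refine Finsupp.sum_congr fun s _ => ?_
  split_ifs <;> simp [mul_add]

theorem traceOut_smul_right (c : ℂ) (ψ φ : State N m) :
    traceOut ψ (c • φ) = star c • traceOut ψ φ := by
  ext k l
  rw [Matrix.smul_apply, traceOut_apply, traceOut_apply, Finset.smul_sum]
  refine Finset.sum_congr rfl fun g _ => ?_
  rw [Finsupp.smul_sum]
  refine Finsupp.sum_congr fun s _ => ?_
  split_ifs <;> simp [mul_left_comm]

theorem traceOut_sum_left {ι : Type*} (s : Finset ι) (ψ : ι → State N m) (φ : State N m) :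
    traceOut (∑ i ∈ s, ψ i) φ = ∑ i ∈ s, traceOut (ψ i) φ :=
  map_sum (AddMonoidHom.mk' (traceOut · φ) fun ψ ψ' => traceOut_add_left ψ ψ' φ) ψ s

theorem traceOut_sum_right {ι : Type*} (s : Finset ι) (ψ : State N m) (φ : ι → State N m) :
    traceOut ψ (∑ i ∈ s, φ i) = ∑ i ∈ s, traceOut ψ (φ i) :=
  map_sum (AddMonoidHom.mk' (traceOut ψ) (traceOut_add_right ψ)) φ s

theorem traceOut_ket (k l : Fin (width N) → Bool) (g g' : Fin m → Bool) (z z' : Coeffs) :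
    traceOut (ket (Sum.elim k g) z) (ket (Sum.elim l g') z') =
      if g = g' ∧ z = z' then Matrix.single k l 1 else 0 := by
  classical
  ext k' l'
  rw [traceOut_apply]
  simp only [ket]
  have h : ∀ h : Fin m → Bool, ((Finsupp.single (Sum.elim k g, z) 1 : State N m).sum fun s c =>
      if s.1 = Sum.elim k' h then
        c * star ((Finsupp.single (Sum.elim l g', z') 1 : State N m) (Sum.elim l' h, s.2)) else 0) =
      if g = h then (if k = k' ∧ l = l' ∧ g' = g ∧ z' = z then 1 else 0) else 0 := by
    intro h
    rw [Finsupp.sum_single_index (by simp)]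
    simp only [Finsupp.single_apply, Sum.elim_eq_iff, Prod.mk.injEq, one_mul]
    by_cases h1 : g = h
    · subst h1
      by_cases h2 : k = k' <;> by_cases h3 : l = l' <;> by_cases h4 : g' = g <;>
        by_cases h5 : z' = z <;> simp [h2, h3, h4, h5]
    · simp [h1]
  simp only [h, Finset.sum_ite_eq, Finset.mem_univ, if_true]
  by_cases h1 : g = g' ∧ z = z'
  · simp [h1.1, h1.2, Matrix.single_apply]
  · rw [if_neg h1, if_neg (fun e => h1 ⟨e.2.2.1.symm, e.2.2.2.symm⟩), Matrix.zero_apply]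

theorem traceOut_ket_bits (R R' : Register N) (z z' : Coeffs) :
    traceOut (ket R.bits z) (ket R'.bits z') =
      if R.anc = R'.anc ∧ z = z' then Matrix.single R.sys R'.sys 1 else 0 := by
  rw [Register.bits, Register.bits, traceOut_ket]
  congr 1
  refine propext (and_congr_left' ⟨fun h => ?_, fun h => by rw [h]⟩)
  funext l
  simpa using congrFun h (Fintype.equivFin _ l)

theorem Register.anc_eq_iff {R R' : Register N} : R.anc = R'.anc ↔
    R.diff = R'.diff ∧ R.lead = R'.lead ∧ R.copy = R'.copy ∧ R.move = R'.move ∧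
      R.side = R'.side ∧ R.jump = R'.jump ∧ R.swap = R'.swap ∧ R.aux = R'.aux := by
  simp [Register.anc, funext_iff, Fin.forall_fin_succ]

end Trace

/-! ### The final state -/

section Final

variable {N : ℕ} {O : Oracle N} (t : ℝ)

open RevOp

/-- The controlled rotations of the jump, swap and purifying qubits. The latter two happen only
after a jump: otherwise their state, which depends on the coefficients, would reveal the pair to the
environment. -/
def rotateSteps : Circuit N (ancillas N) :=
  [controlledStep (flagWire 0) (flagWire 2) (by simp) fun z c => rotation (jumpAngle t z c)] ++
    ([controlledStep (flagWire 2) (flagWire 3) (by simp)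
      fun z c => if c then rotation (swapAngle t z) else 1] ++
    [controlledStep (flagWire 3) (flagWire 4) (by simp)
      fun z c => if c then rotation (auxAngle t z) else 1])

/-- If a jump takes place: the exchange of the side with `swap`, which leaves the old side in the
environment, and the record of the pair. -/
def jumpOps : List (RevOp N (ancillas N)) :=
  [.toffoli (flagWire 2) (flagWire 3) (flagWire 1) (by simp) (by simp) (by simp),
    .toffoli (flagWire 2) (flagWire 1) (flagWire 3) (by simp) (by simp) (by simp)] ++ recordOps

/-- The circuit that simulates the time evolution. -/
def simulation (N : ℕ) (t : ℝ) : Circuit N (ancillas N) :=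
  circuits prepareOps ++
    (rotateSteps t ++ (circuits jumpOps ++ circuits (inverses prepareOps)))

/-- The amplitude of the branch in which there is a jump, with contents `p.1` of the swap qubit and
`p.2` of the purifying qubit; `d` tells whether the basis state differs from its neighbour. -/
def jumpAmplitude (z : Coeffs) (d : Bool) (p : Bool × Bool) : ℝ :=
  Real.sin (jumpAngle t z d) *
    if p.1 then Real.sin (swapAngle t z) *
      (if p.2 then Real.sin (auxAngle t z) else Real.cos (auxAngle t z))
    else if p.2 then 0 else Real.cos (swapAngle t z)

theorem run_rotateSteps (R : Register N) (z : Coeffs) (hj : R.jump = false)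
    (hs : R.swap = false) (ha : R.aux = false) :
    run O (rotateSteps t) (ket R.bits z) =
      (Real.cos (jumpAngle t z R.move) : ℂ) • ket R.bits z
      + ∑ p, (jumpAmplitude t z R.move p : ℂ) • ket (R.setEnv R.copy true p.1 p.2).bits z := by
  have h0 : R.setEnv R.copy false false false = R :=
    Register.setEnv_self rfl hj hs ha
  have hb : ∀ j s e, {R with jump := j, swap := s, aux := e} = R.setEnv R.copy j s e :=
    fun _ _ _ => rfl
  simp only [rotateSteps, run_append, run_controlledStep, run_add, run_smul, Fintype.sum_bool,
    Register.bits_move, Register.bits_jump, Register.bits_swap, Register.bits_aux,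
    Register.update_jump, Register.update_swap, Register.update_aux, hj, hs, ha,
    Fintype.sum_prod_type, jumpAmplitude]
  simp [rotation, hb, h0]
  module

theorem acts_jumpOps (R : Register N) (z : Coeffs) :
    acts O jumpOps (R.bits, z) =
      ({R with
        side := R.side ^^ (R.jump && R.swap)
        swap := R.swap ^^ (R.jump && (R.side ^^ (R.jump && R.swap)))
        copy := fun i => R.copy i ^^ (R.jump && R.sys i)}.bits, z) := by
  rw [jumpOps, acts_append]
  simp only [acts_cons, act_toffoli_bits, Register.bits_side, Register.bits_jump,
    Register.bits_swap, Register.update_side, Register.update_swap]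
  exact acts_recordOps _ z

theorem acts_jumpOps_of_jump_eq_false {R : Register N} {z : Coeffs} (h : R.jump = false) :
    acts O jumpOps (R.bits, z) = (R.bits, z) := by
  cases R
  subst h
  simp [acts_jumpOps]

/-- The final content of the qubits in the branch in which there is a jump, with `p` as in
`jumpAmplitude`. The swap qubit ends up with the side of `x`. At a fixed point the old content of
the swap qubit remains in `side`. -/
def jumpResult (ν : Fin N → Fin N) (x : Fin N) (p : Bool × Bool) : Register N :=
  (Register.start (Register.hop ν x p.1) (p.1 && !(Register.prepared ν x false).move)).setEnv
    (Register.prepared ν x false).sys true (Register.prepared ν x false).side p.2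

theorem run_simulation (hν : Function.Involutive O.nbr)
    (hc : ∀ x, O.coeffs (O.nbr x) = O.coeffs x) (x : Fin N) :
    run O (simulation N t) (initial (ancillas N) x) =
      (Real.cos (jumpAngle t (O.coeffs x) (decide (O.nbr x ≠ x))) : ℂ) •
        ket (Register.start x false).bits 0
      + ∑ p, (jumpAmplitude t (O.coeffs x) (decide (O.nbr x ≠ x)) p : ℂ) •
        ket (jumpResult O.nbr x p).bits 0 := by
  have hinit : initial (ancillas N) x = ket (Register.start x false).bits 0 := by
    rw [initial, ket]
    congr 2
    refine Register.bits_eq (fun i => rfl) fun l => ?_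
    rcases l with i | i | i | c
    · rfl
    · rfl
    · rfl
    · fin_cases c <;> rfl
  obtain ⟨e1, e2, e3, e4⟩ := Register.prepared_env O.nbr x
  have h1 : run O (circuits prepareOps) (ket (Register.start x false).bits 0) =
      ket (Register.prepared O.nbr x false).bits (O.coeffs x) := by
    have := acts_prepareOps (O := O) x false (fun _ => false) false false false
    rw [Register.start_setEnv, Register.setEnv_self e1 e2 e3 e4] at this
    rw [run_circuits _ (_, _), this]
  have h2 : run O (circuits jumpOps ++ circuits (inverses prepareOps))
      (ket (Register.prepared O.nbr x false).bits (O.coeffs x)) =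
        ket (Register.start x false).bits 0 := by
    have := acts_inverses_prepareOps hν hc x false (fun _ => false) false false false
    rw [Bool.xor_false, Register.setEnv_self e1 e2 e3 e4, Bool.false_and,
      Register.start_setEnv] at this
    rw [run_append, run_circuits _ (_, _), acts_jumpOps_of_jump_eq_false e2,
      run_circuits _ (_, _), this]
    rfl
  have h3 : ∀ p : Bool × Bool, run O (circuits jumpOps ++ circuits (inverses prepareOps))
      (ket ((Register.prepared O.nbr x false).setEnv (Register.prepared O.nbr x false).copy
        true p.1 p.2).bits (O.coeffs x)) = ket (jumpResult O.nbr x p).bits 0 := by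
    intro p
    have := acts_inverses_prepareOps hν hc x p.1 (Register.prepared O.nbr x false).sys true
      (Register.prepared O.nbr x false).side p.2
    rw [run_append, run_circuits _ (_, _), acts_jumpOps]
    simp only [Register.setEnv, e1, Bool.true_and, Bool.false_xor]
    -- The exchange leaves the old side in the swap qubit.
    have hx : (p.1 ^^ ((Register.prepared O.nbr x false).side ^^ p.1)) =
        (Register.prepared O.nbr x false).side := by
      cases p.1 <;> simp
    rw [hx, run_circuits _ (_, _)]
    exact congrArg (fun s : BasisState N (ancillas N) => ket s.1 s.2) this
  rw [hinit, simulation, run_append, h1, run_append, run_rotateSteps t _ _ e2 e3 e4, run_add,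
    run_smul, h2, Register.prepared_move]
  simp only [run_sum, run_smul, h3]

end Final

/-! ### The channel of the simulation circuit -/

section Channel

variable {N : ℕ} {ν : Fin N → Fin N} {a a' b : Fin N → ℝ}
  {A : Matrix (Fin N × Fin N) (Fin N × Fin N) ℂ} {t : ℝ}

theorem embed_apply (M : Matrix (Fin N) (Fin N) ℂ) :
    embed M = ∑ k, ∑ l, M k l • Matrix.single (encode k) (encode l) (1 : ℂ) := by
  simp [embed, Matrix.smul_single]

theorem embed_add (M M' : Matrix (Fin N) (Fin N) ℂ) : embed (M + M') = embed M + embed M' := by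
  simp [embed_apply, add_smul, Finset.sum_add_distrib]

theorem embed_smul (c : ℂ) (M : Matrix (Fin N) (Fin N) ℂ) : embed (c • M) = c • embed M := by
  simp only [embed_apply, Matrix.smul_apply, smul_eq_mul, mul_smul, Finset.smul_sum]

theorem embed_sum {ι : Type*} (s : Finset ι) (M : ι → Matrix (Fin N) (Fin N) ℂ) :
    embed (∑ i ∈ s, M i) = ∑ i ∈ s, embed (M i) :=
  map_sum (AddMonoidHom.mk' embed embed_add) M s

theorem embed_single (x y : Fin N) :
    embed (Matrix.single x y (1 : ℂ)) = Matrix.single (encode x) (encode y) 1 := by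
  rw [embed_apply, Finset.sum_eq_single x, Finset.sum_eq_single y]
  · simp
  · intro l _ hl; simp [Ne.symm hl]
  · simp
  · intro k _ hk
    refine Finset.sum_eq_zero fun l _ => ?_
    simp [Ne.symm hk]
  · simp

/-- A linear superoperator is determined by its values on the matrix units. -/
theorem embed_evolution_eq_sum (L : Matrix (Fin N) (Fin N) ℂ →ₗ[ℂ] Matrix (Fin N) (Fin N) ℂ)
    (t : ℝ) (ρ : Matrix (Fin N) (Fin N) ℂ) : embed (evolution L t ρ) =
      ∑ x, ∑ y, ρ x y • embed (evolution L t (Matrix.single x y 1)) := by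
  conv_lhs => rw [Matrix.matrix_eq_sum_single ρ]
  simp only [evolution_sum, embed_sum]
  refine Finset.sum_congr rfl fun x _ => Finset.sum_congr rfl fun y _ => ?_
  have : Matrix.single x y (ρ x y) = ρ x y • Matrix.single x y (1 : ℂ) := by
    simp [Matrix.smul_single]
  rw [this, evolution_smul, embed_smul]

theorem channel_eq_embed_evolution {m : ℕ} {O : Oracle N} {P : Circuit N m}
    {L : Matrix (Fin N) (Fin N) ℂ →ₗ[ℂ] Matrix (Fin N) (Fin N) ℂ}
    (h : ∀ x y, traceOut (run O P (initial m x)) (run O P (initial m y)) =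
      embed (evolution L t (Matrix.single x y 1))) (ρ : Matrix (Fin N) (Fin N) ℂ) :
    channel O P ρ = embed (evolution L t ρ) := by
  simp only [channel, h, embed_evolution_eq_sum L t ρ]

/-- The final state of the simulation circuit on the basis state `x`. -/
def finalState (t : ℝ) (ν : Fin N → Fin N) (x : Fin N) (z : Coeffs) : State N (ancillas N) :=
  (Real.cos (jumpAngle t z (decide (ν x ≠ x))) : ℂ) • ket (Register.start x false).bits 0
    + ∑ p, (jumpAmplitude t z (decide (ν x ≠ x)) p : ℂ) • ket (jumpResult ν x p).bits 0

theorem traceOut_start (x y : Fin N) :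
    traceOut (ket (Register.start x false).bits 0) (ket (Register.start y false).bits 0) =
      Matrix.single (encode x) (encode y) 1 := by
  rw [traceOut_ket_bits, if_pos ⟨rfl, rfl⟩]
  rfl

/-- The jump qubit separates the branches with and without a jump. -/
theorem traceOut_start_jumpResult (x y : Fin N) (p : Bool × Bool) :
    traceOut (ket (Register.start x false).bits 0) (ket (jumpResult ν y p).bits 0) = 0 := by
  rw [traceOut_ket_bits, if_neg]
  simp [Register.anc_eq_iff, Register.start, jumpResult, Register.setEnv]

theorem traceOut_jumpResult_start (x y : Fin N) (p : Bool × Bool) :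
    traceOut (ket (jumpResult ν x p).bits 0) (ket (Register.start y false).bits 0) = 0 := by
  rw [traceOut_ket_bits, if_neg]
  simp [Register.anc_eq_iff, Register.start, jumpResult, Register.setEnv]

/-- After a jump the environment knows from which basis state it started. -/
theorem traceOut_jumpResult_of_ne (hν : Function.Involutive ν) {x y : Fin N} (hxy : x ≠ y)
    (p q : Bool × Bool) :
    traceOut (ket (jumpResult ν x p).bits 0) (ket (jumpResult ν y q).bits 0) = 0 := by
  rw [traceOut_ket_bits, if_neg]
  rw [Register.anc_eq_iff]
  simp only [Register.start, jumpResult, Register.setEnv]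
  rintro ⟨⟨-, -, hsys, -, -, -, hside, -⟩, -⟩
  exact hxy (Register.eq_of_prepared_eq hν hsys hside)

/-- At a fixed point, `side` ends up with `p.1`, so that the branches with different swap qubits do
not interfere; the system is in the state `x` in both of them. -/
theorem traceOut_jumpResult_self (x : Fin N) (p q : Bool × Bool) :
    traceOut (ket (jumpResult ν x p).bits 0) (ket (jumpResult ν x q).bits 0) =
      if (p.1 && decide (ν x = x)) = (q.1 && decide (ν x = x)) ∧ p.2 = q.2 then
        Matrix.single (encode (Register.hop ν x p.1)) (encode (Register.hop ν x q.1)) 1 else 0 := by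
  simp [traceOut_ket_bits, Register.anc_eq_iff, jumpResult, Register.start, Register.setEnv,
    Register.prepared_move]

theorem traceOut_finalState (x y : Fin N) (z z' : Coeffs) :
    traceOut (finalState t ν x z) (finalState t ν y z') =
      ((Real.cos (jumpAngle t z (decide (ν x ≠ x))) *
        Real.cos (jumpAngle t z' (decide (ν y ≠ y))) : ℝ) : ℂ) •
          Matrix.single (encode x) (encode y) (1 : ℂ) +
      ∑ p, ∑ q, ((jumpAmplitude t z (decide (ν x ≠ x)) p *
        jumpAmplitude t z' (decide (ν y ≠ y)) q : ℝ) : ℂ) •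
          traceOut (ket (jumpResult ν x p).bits 0) (ket (jumpResult ν y q).bits 0) := by
  simp only [finalState, traceOut_add_left, traceOut_add_right, traceOut_smul_left,
    traceOut_smul_right, traceOut_sum_left, traceOut_sum_right, traceOut_start,
    traceOut_start_jumpResult, traceOut_jumpResult_start, smul_zero, Finset.sum_const_zero,
    add_zero, zero_add, RCLike.star_def, Complex.conj_ofReal, smul_smul, Complex.ofReal_mul,
    Finset.smul_sum]
  congr 1
  · rw [mul_comm]
  · rw [Finset.sum_comm]
    refine Finset.sum_congr rfl fun p _ => Finset.sum_congr rfl fun q _ => ?_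
    rw [mul_comm]

namespace IsOneKetSparse

theorem cos_jumpAngle_eq (h : IsOneKetSparse ν a a' b A) (ht : 0 < t) (x : Fin N) :
    Real.cos (jumpAngle t (a x, a' x, b x) (decide (ν x ≠ x))) =
      Real.exp (-(decayRate ν a a' x * t)) := by
  rw [cos_jumpAngle ht (h.a_nonneg x) (h.a'_nonneg x), decayRate]
  by_cases hx : ν x = x <;> simp [hx]

theorem traceOut_finalState_eq (h : IsOneKetSparse ν a a' b A) (ht : 0 < t) (x y : Fin N) :
    traceOut (finalState t ν x (a x, a' x, b x)) (finalState t ν y (a y, a' y, b y)) =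
      embed (evolution (gks A) t (Matrix.single x y 1)) := by
  rw [traceOut_finalState]
  by_cases hxy : x = y
  · subst hxy
    simp only [traceOut_jumpResult_self]
    by_cases hx : ν x = x
    · rw [h.evolution_single_of_fixed t hx, embed_single]
      simp only [hx, ne_eq, not_true_eq_false, decide_false, decide_true, Bool.and_true,
        Register.hop, ite_self, jumpAmplitude, Fintype.sum_prod_type, Fintype.sum_bool,
        if_true, if_false, and_true, and_false,
        Bool.false_eq_true, Bool.true_eq_false, smul_zero, add_zero, zero_add]
      simp only [← add_smul, ← Complex.ofReal_add]
      have hsum : ∀ α β γ : ℝ, Real.cos α * Real.cos α +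
          (Real.sin α * (Real.sin β * Real.sin γ) * (Real.sin α * (Real.sin β * Real.sin γ)) +
            Real.sin α * (Real.sin β * Real.cos γ) * (Real.sin α * (Real.sin β * Real.cos γ)) +
          (Real.sin α * 0 * (Real.sin α * 0) +
            Real.sin α * Real.cos β * (Real.sin α * Real.cos β))) = 1 := fun α β γ => by
        linear_combination Real.sin_sq_add_cos_sq α + Real.sin α ^ 2 * Real.sin_sq_add_cos_sq β +
          Real.sin α ^ 2 * Real.sin β ^ 2 * Real.sin_sq_add_cos_sq γ
      rw [hsum, Complex.ofReal_one, one_smul]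
    · rw [h.evolution_single_self t hx]
      simp only [embed_add, embed_smul, embed_single]
      simp only [hx, ne_eq, not_false_eq_true, decide_false, decide_true, Bool.and_false,
        Register.hop, jumpAmplitude, Fintype.sum_prod_type, Fintype.sum_bool, true_and,
        if_true, if_false, Bool.false_eq_true, Bool.true_eq_false, smul_zero,
        add_zero, zero_add]
      have ha := h.a_nonneg x
      have ha' := h.a'_nonneg x
      have hw := weight_swap ht ha ha' (h.b_sq_le x)
      rw [← weight_coherence ht ha ha' (h.b_sq_le x)]
      set α := jumpAngle t (a x, a' x, b x) true
      set β := swapAngle t (a x, a' x, b x)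
      set γ := auxAngle t (a x, a' x, b x)
      have e1 : (1 + Real.exp (-(4 * a x * t))) / 2 =
          Real.cos α * Real.cos α + Real.sin α * Real.cos β * (Real.sin α * Real.cos β) := by
        linear_combination hw - Real.sin_sq_add_cos_sq α -
          Real.sin α ^ 2 * Real.sin_sq_add_cos_sq β
      have e2 : (1 - Real.exp (-(4 * a x * t))) / 2 =
          Real.sin α * (Real.sin β * Real.sin γ) * (Real.sin α * (Real.sin β * Real.sin γ)) +
          Real.sin α * (Real.sin β * Real.cos γ) * (Real.sin α * (Real.sin β * Real.cos γ)) := by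
        linear_combination -hw -
          Real.sin α ^ 2 * Real.sin β ^ 2 * Real.sin_sq_add_cos_sq γ
      rw [e1, e2]
      simp only [Complex.ofReal_add, Complex.ofReal_mul, Complex.ofReal_pow, Complex.ofReal_zero]
      module
  · rw [h.evolution_single_of_ne t hxy, embed_smul, embed_single, h.cos_jumpAngle_eq ht,
      h.cos_jumpAngle_eq ht]
    simp only [traceOut_jumpResult_of_ne h.involutive hxy, smul_zero, Finset.sum_const_zero,
      add_zero]

/-- The channel of the simulation circuit is the time evolution. -/
theorem channel_simulation (h : IsOneKetSparse ν a a' b A) (ht : 0 < t)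
    (ρ : Matrix (Fin N) (Fin N) ℂ) :
    channel ⟨ν, fun x => (a x, a' x, b x)⟩ (simulation N t) ρ =
      embed (evolution (gks A) t ρ) := by
  refine channel_eq_embed_evolution (fun x y => ?_) ρ
  have hc : ∀ x, (a (ν x), a' (ν x), b (ν x)) = (a x, a' x, b x) := fun x => by
    rw [h.a_nbr, h.a'_nbr, h.b_nbr]
  rw [run_simulation t h.involutive hc, run_simulation t h.involutive hc]
  exact h.traceOut_finalState_eq ht x y

/-- A single level does not evolve. -/
theorem channel_nil [Subsingleton (Fin N)] (h : IsOneKetSparse ν a a' b A)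
    (ρ : Matrix (Fin N) (Fin N) ℂ) :
    channel ⟨ν, fun x => (a x, a' x, b x)⟩ ([] : Circuit N 0) ρ =
      embed (evolution (gks A) t ρ) := by
  refine channel_eq_embed_evolution (fun x y => ?_) ρ
  obtain rfl := Subsingleton.elim x y
  rw [h.evolution_single_of_fixed t (Subsingleton.elim _ _), embed_single]
  exact (traceOut_ket _ _ _ _ _ _).trans (if_pos ⟨rfl, rfl⟩)

end IsOneKetSparse

end Channel

/-! ### Counting gates and queries -/

section Count

open RevOp

variable {N m : ℕ}

theorem RevOp.gateCount_circuit_le (op : RevOp N m) : gateCount op.circuit ≤ 5 := by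
  cases op <;> simp [circuit, OneKet.toffoli, cnotStep, controlledStep, gateCount]

theorem gateCount_circuits_le (l : List (RevOp N m)) : gateCount (circuits l) ≤ 5 * l.length := by
  induction l with
  | nil => simp [circuits, gateCount]
  | cons op l ih =>
    rw [circuits, List.flatMap_cons, gateCount_append, List.length_cons]
    have := op.gateCount_circuit_le
    rw [circuits] at ih
    omega

theorem gateCount_simulation_le (N : ℕ) (t : ℝ) :
    gateCount (simulation N t) ≤ 65 * width N + 23 := by
  have hp : (prepareOps (N := N)).length = 6 * width N + 1 := by
    simp [prepareOps, compareOps, canonicalizeOps, scanOps, List.length_flatMap]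
    ring
  have hi : (inverses (prepareOps (N := N))).length = 6 * width N + 1 := by
    rw [inverses, List.length_reverse, List.length_map, hp]
  have hj : (jumpOps (N := N)).length = width N + 2 := by
    simp [jumpOps, recordOps]
  have h1 := gateCount_circuits_le (prepareOps (N := N))
  have h2 := gateCount_circuits_le (inverses (prepareOps (N := N)))
  have h3 := gateCount_circuits_le (jumpOps (N := N))
  have h4 : gateCount (rotateSteps (N := N) t) = 3 := rfl
  rw [simulation, gateCount_append, gateCount_append, gateCount_append]
  omega

theorem queryCount_circuits (l : List (RevOp N m)) :
    queryCount (circuits l) = (l.map fun op => queryCount op.circuit).sum := by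
  induction l with
  | nil => rfl
  | cons op l ih =>
    rw [circuits, List.flatMap_cons, queryCount_append, List.map_cons, List.sum_cons, ← ih,
      circuits]

theorem queryCount_inverses (l : List (RevOp N m)) :
    queryCount (circuits (inverses l)) = queryCount (circuits l) := by
  rw [queryCount_circuits, queryCount_circuits, inverses, List.map_reverse, List.sum_reverse,
    List.map_map]
  congr 2
  funext op
  cases op <;> rfl

theorem queryCount_simulation (N : ℕ) (t : ℝ) : queryCount (simulation N t) = 2 := by
  have hp : queryCount (circuits (prepareOps (N := N))) = 1 := by
    simp [queryCount_circuits, prepareOps, compareOps, canonicalizeOps, scanOps, circuit,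
      queryCount, toffoli, cnotStep, controlledStep, List.map_flatMap, Function.comp_def]
    refine List.sum_eq_zero fun k hk => ?_
    obtain ⟨_, _, h⟩ := List.mem_flatMap.1 hk
    simpa using h
  have hj : queryCount (circuits (jumpOps (N := N))) = 0 := by
    simp [queryCount_circuits, jumpOps, recordOps, circuit, queryCount, toffoli, cnotStep,
      controlledStep, Function.comp_def]
  have hr : queryCount (rotateSteps (N := N) t) = 0 := rfl
  rw [simulation, queryCount_append, queryCount_append, queryCount_append, queryCount_inverses,
    hp, hj, hr]

theorem width_le_log {N : ℕ} (hN : 2 ≤ N) : (width N : ℝ) ≤ 4 * Real.log N := by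
  have h1 : width N ≤ Nat.log 2 N + 1 :=
    Nat.clog_le_of_le_pow (Nat.lt_pow_succ_log_self one_lt_two N).le
  have h2 : 1 ≤ Nat.log 2 N := Nat.log_pos one_lt_two hN
  have h3 : (width N : ℝ) ≤ 2 * Nat.log 2 N := by
    exact_mod_cast (by omega : width N ≤ 2 * Nat.log 2 N)
  have h4 : (Nat.log 2 N : ℝ) * Real.log 2 ≤ Real.log N := by
    rw [← Real.log_pow]
    refine Real.log_le_log (by positivity) ?_
    exact_mod_cast Nat.pow_log_le_self 2 (by omega)
  have h5 := Real.log_two_gt_d9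
  nlinarith [(Nat.cast_nonneg (Nat.log 2 N) : (0 : ℝ) ≤ _)]

end Count

end OneKet

end

theorem mainTheorem7 :
    ∃ (C : ℝ) (Q : ℕ), ∀ N : ℕ, 1 ≤ N → ∀ t : ℝ, 0 < t →
      ∃ (m : ℕ) (P : OneKet.Circuit N m),
        (OneKet.gateCount P : ℝ) ≤ C * Real.log N ∧
        OneKet.queryCount P ≤ Q ∧
        ∀ (ν : Fin N → Fin N) (a a' b : Fin N → ℝ)
          (A : Matrix (Fin N × Fin N) (Fin N × Fin N) ℂ),
          OneKet.IsOneKetSparse ν a a' b A →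
          ∀ ρ : Matrix (Fin N) (Fin N) ℂ,
            OneKet.channel ⟨ν, fun x => (a x, a' x, b x)⟩ P ρ =
              OneKet.embed (OneKet.evolution (OneKet.gks A) t ρ) := by
  -- At most `65 ⌈log₂ N⌉ + 23 ≤ 88 ⌈log₂ N⌉` gates, and `⌈log₂ N⌉ ≤ 4 log N`.
  refine ⟨352, 2, fun N hN t ht => ?_⟩
  rcases hN.eq_or_lt with rfl | hN
  · -- For `N = 1` the bound `C log N` is zero, and the empty circuit does it.
    exact ⟨0, [], by simp [OneKet.gateCount], by simp [OneKet.queryCount],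
      fun ν a a' b A h ρ => h.channel_nil ρ⟩
  · refine ⟨_, OneKet.simulation N t, ?_, (OneKet.queryCount_simulation N t).le,
      fun ν a a' b A h ρ => h.channel_simulation ht ρ⟩
    have h1 : (OneKet.gateCount (OneKet.simulation N t) : ℝ) ≤ 65 * OneKet.width N + 23 := by
      exact_mod_cast OneKet.gateCount_simulation_le N t
    have h2 : (1 : ℝ) ≤ OneKet.width N := by
      exact_mod_cast Nat.clog_pos one_lt_two hN
    have h3 := OneKet.width_le_log hN
    linarith
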